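/- Let $m\ge 1$ and let $\alpha=(\alpha_1,\dots,\alpha_m)$ be a tuple of positive real numbers which is generic, i.e. $\sum_{i=1}^m\pm\alpha_i\neq 0$ for every choice of signs. Let $\delta>\sum_{i=1}^{m-1}\alpha_i$ be a positive real number and put $\alpha'=(\alpha_1,\dots,\alpha_{m-1},\delta,\alpha_m+\delta)$. Let $$\mathrm{Ch}(\alpha)=\Big\{(v_1,\dots,v_{m-1})\in (S^1)^{m-1} : \sum_{i=1}^{m-1}\alpha_i x_i=\alpha_m\Big\}\Big/\mathbb Z_2,\qquad v_i=(x_i,y_i)\in\mathbb R^2,$$ where $\mathbb Z_2$ acts diagonally by the reflection in the $X$-axis, and let $$\overline{\mathrm M}_{\alpha'}=\Big\{(v_1,\dots,v_{m+1})\in (S^1)^{m+1} : \sum_{i=1}^{m+1}\alpha'_i v_i=0\Big\}\Big/\mathrm O_2,$$ where $\mathrm O_2$ acts diagonally. Both carry the quotient topology. Call a smooth structure on one of these quotients natural if a real function on an open subset is smooth exactly when its pullback to the set of tuples is smooth, i.e. is locally the restriction of a smooth function of $(v_1,v_2,\dots)$ on an open set of the ambient vector space. Then both spaces have a natural smooth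 structure (necessarily unique) of dimension $m-2$ (if $m=1$, both spaces are empty), and with these structures $\mathrm{Ch}(\alpha)$ is diffeomorphic to $\overline{\mathrm M}_{\alpha'}$. Explicitly, for a chain $v=(v_1,\dots,v_{m-1})$ put $p=\sum_{i=1}^{m-1}\alpha_iv_i=(\alpha_m,y)$, and fix $s\in\{1,-1\}$. There is exactly one pair $(w,x)\in S^1\times S^1$ with $$p+\delta w+(\alpha_m+\delta)x=0\qquad\text{and}\qquad s\,y\,\det(p,w)\ge 0,$$ that is, exactly one triangle with sides $p$, $\delta w$, $(\alpha_m+\delta)x$ lying on the prescribed side of $p$. For each of the two values of $s$ there is a diffeomorphism $\mathrm{Ch}(\alpha)\to\overline{\mathrm M}_{\alpha'}$ that maps the class of every chain $(v_1,\dots,v_{m-1})$ to the class of the closed polygon $(v_1,\dots,v_{m-1},w,x)$. -/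

import Mathlib

open scoped Manifold ContDiff

/-- A length vector is generic when no signed sum of its entries vanishes. -/
def IsGeneric {m : ℕ} (α : Fin m → ℝ) : Prop :=
  ∀ ε : Fin m → ℝ, (∀ i, ε i = 1 ∨ ε i = -1) → ∑ i, ε i * α i ≠ 0

/-! The plane is `ℂ`, so `x = re`, `y = im`, the unit circle is `‖v‖ = 1`, the reflection in the
`X`-axis is complex conjugation, and the orthogonal group `O₂` is `ℂ ≃ₗᵢ[ℝ] ℂ`. -/

/-! ### Chains -/

/-- The endpoint `∑_{i<m} αᵢ vᵢ` of the path with directions `v₁, …, v_{m-1}`; here `m = n + 1`. -/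
noncomputable def chainEnd {n : ℕ} (α : Fin (n + 1) → ℝ) (v : Fin n → ℂ) : ℂ :=
  ∑ i : Fin n, (α i.castSucc : ℂ) * v i

/-- The chains with side lengths `α₁, …, α_{m-1}` that end on the line `x = α_m`. -/
def chainSet {n : ℕ} (α : Fin (n + 1) → ℝ) : Set (Fin n → ℂ) :=
  {v | (∀ i, ‖v i‖ = 1) ∧ (chainEnd α v).re = α (Fin.last n)}

/-- Two chains are identified when they are equal or mirror images in the `X`-axis: the orbit
relation of the diagonal action of `ℤ/2`. -/
def chainSetoid {n : ℕ} (α : Fin (n + 1) → ℝ) : Setoid (chainSet α) where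
  r u v := u = v ∨ ∀ i, u.1 i = (starRingEnd ℂ) (v.1 i)
  iseqv :=
    { refl := fun _ => Or.inl rfl
      symm := by
        rintro u v (h | h)
        · exact Or.inl h.symm
        · exact Or.inr fun i => by rw [h i, Complex.conj_conj]
      trans := by
        rintro u v w (rfl | h) (rfl | k)
        · exact Or.inl rfl
        · exact Or.inr k
        · exact Or.inr h
        · exact Or.inl (Subtype.ext (funext fun i => by rw [h i, k i, Complex.conj_conj])) }

/-- The chain space `Ch(α)`, with the quotient topology. -/
abbrev ChainSpace {n : ℕ} (α : Fin (n + 1) → ℝ) : Type := Quotient (chainSetoid α)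

/-- The class of a chain. -/
def ChainSpace.mk {n : ℕ} (α : Fin (n + 1) → ℝ) (v : chainSet α) : ChainSpace α :=
  Quotient.mk (chainSetoid α) v

/-! ### Planar polygons -/

/-- The closed planar polygons with side lengths `β`, given by the directions of their sides. -/
def polygonSet {k : ℕ} (β : Fin k → ℝ) : Set (Fin k → ℂ) :=
  {v | (∀ i, ‖v i‖ = 1) ∧ ∑ i, (β i : ℂ) * v i = 0}

/-- The orbit relation of the diagonal action of `O₂`. -/
def polygonSetoid {k : ℕ} (β : Fin k → ℝ) : Setoid (polygonSet β) where
  r u v := ∃ g : ℂ ≃ₗᵢ[ℝ] ℂ, ∀ i, u.1 i = g (v.1 i)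
  iseqv :=
    { refl := fun _ => ⟨LinearIsometryEquiv.refl ℝ ℂ, fun _ => rfl⟩
      symm := by
        rintro u v ⟨g, h⟩
        exact ⟨g.symm, fun i => by rw [h i, g.symm_apply_apply]⟩
      trans := by
        rintro u v w ⟨g, h⟩ ⟨g', h'⟩
        exact ⟨g'.trans g, fun i => by rw [h i, h' i]; rfl⟩ }

/-- The planar polygon space of `β`, with the quotient topology. -/
abbrev PolygonSpace {k : ℕ} (β : Fin k → ℝ) : Type := Quotient (polygonSetoid β)

/-- The class of a closed polygon. -/
def PolygonSpace.mk {k : ℕ} (β : Fin k → ℝ) (v : polygonSet β) : PolygonSpace β :=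
  Quotient.mk (polygonSetoid β) v

/-! ### Smooth structures -/

/-- `π : A → X` is the projection of a subset `A` of a vector space `V` onto a quotient `X` of it.
The atlas of `X` is natural when it is smooth and its smooth functions are the expected ones: a
real function `f` on an open set `U` of `X` is smooth if and only if its pullback `f ∘ π` is smooth
as a function on a subset of `V`, that is, near each point of `A` over `U` it is the restriction of
a smooth function on an open set of `V`.

If `A` is an embedded submanifold and `X` is its quotient by a free smooth action of a compact
Lie group, these are exactly the atlases of the usual quotient smooth structure (the one for which
`π` is a smooth submersion): a smooth structure is determined by its sheaf of smooth functions. -/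
structure IsNaturalSmoothStructure (d : ℕ) {V X : Type} [NormedAddCommGroup V] [NormedSpace ℝ V]
    {A : Set V} [TopologicalSpace X] [ChartedSpace (EuclideanSpace ℝ (Fin d)) X]
    (π : A → X) : Prop where
  isManifold : IsManifold (𝓡 d) ∞ X
  smooth_iff : ∀ (U : Set X), IsOpen U → ∀ f : X → ℝ,
    ContMDiffOn (𝓡 d) 𝓘(ℝ, ℝ) ∞ f U ↔
      ∀ a : A, π a ∈ U → ∃ W : Set V, IsOpen W ∧ a.1 ∈ W ∧ ∃ g : V → ℝ,
        ContDiffOn ℝ ∞ g W ∧ ∀ b : A, b.1 ∈ W → f (π b) = g b.1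

/-! ### Closing a chain with a triangle -/

/-- The length vector `α' = (α₁, …, α_{m-1}, δ, α_m + δ)`. -/
noncomputable def extendedLengths {n : ℕ} (α : Fin (n + 1) → ℝ) (δ : ℝ) : Fin (n + 2) → ℝ :=
  Fin.snoc (α := fun _ => ℝ) (Fin.snoc (α := fun _ => ℝ) (fun i : Fin n => α i.castSucc) δ)
    (α (Fin.last n) + δ)

/-- The closed polygon `P = (v₁, …, v_{m-1}, w, x)` with side lengths `α'` arises from the chain `v`
by attaching a triangle: its first sides are those of `v`, so that, with `p` the endpoint of `v`,
the vectors `p`, `δ w`, `(α_m + δ) x` add up to zero and are the sides of a triangle.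
The last condition says on which side of the line through `0` and `p` this triangle
lies: `s * im p * det (p, w)` is nonnegative. -/
def ClosesChain {n : ℕ} (α : Fin (n + 1) → ℝ) (δ s : ℝ) (v : chainSet α)
    (P : polygonSet (extendedLengths α δ)) : Prop :=
  (∀ i : Fin n, P.1 i.castSucc.castSucc = v.1 i) ∧
    0 ≤ s * (chainEnd α v.1).im *
      ((chainEnd α v.1).re * (P.1 (Fin.last n).castSucc).im
        - (chainEnd α v.1).im * (P.1 (Fin.last n).castSucc).re)

/-! Write `c` for the last length and `p` for the vector from the start to the end of the open path.
The triangle condition `p + δ w + (c + δ) x = 0` fixes the scalar product of `p` and `w` by the law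
of cosines, and then gives `det (p, w)² = (|p|² - c²) K` with `K = 1 + c/δ - (|p|² - c²)/(4δ²)`.
Since `|p| < δ`, the factor `K` is positive and `√K` is smooth.

For a chain, `p = c + i y` and `|p|² - c² = y²`, so `det (p, w) = ± y √K`. The side condition
selects `s y √K`. Letting the side depend on the sign of `y` makes `w` smooth through the degenerate
triangles `y = 0`, and makes the construction commute with reflection.

Conversely, the triangle inequality gives `|p| ≥ c > 0` for a closed polygon, and `y = s det (p, w)
/ √K` satisfies `c² + y² = |p|²`. Multiplication by the unit number `(c + i y) / p` therefore turns
the first sides into a chain. This chain does not change when the polygon is rotated, and it is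
conjugated when the polygon is reflected. The two constructions, `closeChain` and `openPolygon`, are
inverse to each other on the quotients and are smooth on open sets of the ambient spaces.

Charts of the chain space come from genericity: some side `vⱼ` is not horizontal, the sign of its
ordinate picks one chain of each mirror pair, and the other sides are free coordinates.
`SmoothSlice.transfer` carries these slices to the polygon space. A map of quotients with smooth
lifts pulls smooth functions back to smooth functions, hence is smooth for all natural structures
(`LiftsSmoothly.contMDiff`). -/

open Topology Set Filter

/-! ### Natural smooth structures from slices and smooth symmetries -/

section NaturalStructures

variable {V V' X Y : Type} [NormedAddCommGroup V] [NormedSpace ℝ V]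
  [NormedAddCommGroup V'] [NormedSpace ℝ V'] {A : Set V} {B : Set V'}

/-- Near each point of `A`, the relation `π a = π a'` is realised by smooth symmetries of `π`. -/
def HasSmoothSymmetries (π : A → X) : Prop :=
  ∀ a a' : A, π a = π a' → ∃ G : V → V, ContDiff ℝ ∞ G ∧ G a = a' ∧
    ∀ b : A, ∃ h : G b ∈ A, π ⟨G b, h⟩ = π b

/-- A local chart of the quotient `X` of `A`, presented by smooth maps `coord` and `param` between
open subsets of the ambient vector space and of the model space. -/
structure SmoothSlice (E : Type) [NormedAddCommGroup E] [NormedSpace ℝ E] (π : A → X) where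
  dom : Set V
  codom : Set E
  coord : V → E
  param : E → V
  isOpen_dom : IsOpen dom
  isOpen_codom : IsOpen codom
  contDiffOn_coord : ContDiffOn ℝ ∞ coord dom
  contDiffOn_param : ContDiffOn ℝ ∞ param codom
  coord_mem : ∀ a : A, a.1 ∈ dom → coord a ∈ codom
  param_mem : ∀ t ∈ codom, param t ∈ A
  param_mem_dom : ∀ t ∈ codom, param t ∈ dom
  coord_param : ∀ t ∈ codom, coord (param t) = t
  proj_param_coord : ∀ a : A, ∀ h : a.1 ∈ dom,
    π ⟨param (coord a), param_mem _ (coord_mem a h)⟩ = π a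
  coord_eq : ∀ a b : A, a.1 ∈ dom → b.1 ∈ dom → π a = π b → coord a = coord b

/-- The pullback of `f` along `π` is smooth over `U`. -/
def SmoothPullbackOn (π : A → X) (f : X → ℝ) (U : Set X) : Prop :=
  ∀ a : A, π a ∈ U → ∃ W : Set V, IsOpen W ∧ a.1 ∈ W ∧ ∃ g : V → ℝ,
    ContDiffOn ℝ ∞ g W ∧ ∀ b : A, b.1 ∈ W → f (π b) = g b.1

/-- The map `Ψ` of quotients has local smooth lifts. -/
def LiftsSmoothly (π : A → X) (π' : B → Y) (Ψ : X → Y) : Prop :=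
  ∀ a : A, ∃ W : Set V, IsOpen W ∧ a.1 ∈ W ∧ ∃ G : V → V', ContDiffOn ℝ ∞ G W ∧
    ∀ b : A, b.1 ∈ W → ∃ h : G b ∈ B, π' ⟨G b, h⟩ = Ψ (π b)

theorem SmoothPullbackOn.comp {π : A → X} {π' : B → Y} {Ψ : X → Y} {f : Y → ℝ} {U : Set Y}
    (hf : SmoothPullbackOn π' f U) (hΨ : LiftsSmoothly π π' Ψ) :
    SmoothPullbackOn π (f ∘ Ψ) (Ψ ⁻¹' U) := by
  intro a ha
  obtain ⟨W, hW, haW, G, hG, hGπ⟩ := hΨ a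
  obtain ⟨hGa, hGa'⟩ := hGπ a haW
  obtain ⟨W', hW', haW', g, hg, hfg⟩ := hf ⟨G a, hGa⟩ (by rw [hGa']; exact ha)
  refine ⟨W ∩ G ⁻¹' W', hG.continuousOn.isOpen_inter_preimage hW hW', ⟨haW, haW'⟩, g ∘ G,
    hg.comp (hG.mono inter_subset_left) fun _ hx => hx.2, fun b hb => ?_⟩
  obtain ⟨hGb, hGb'⟩ := hGπ b hb.1
  simpa [hGb'] using hfg ⟨G b, hGb⟩ hb.2

namespace SmoothSlice

variable {E : Type} [NormedAddCommGroup E] [NormedSpace ℝ E] {π : A → X}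

open Classical in
/-- The coordinates of a point of the quotient. -/
noncomputable def toFun (φ : SmoothSlice E π) (x : X) : E :=
  if h : ∃ a : A, a.1 ∈ φ.dom ∧ π a = x then φ.coord h.choose else 0

theorem toFun_proj (φ : SmoothSlice E π) {a : A} (ha : a.1 ∈ φ.dom) :
    φ.toFun (π a) = φ.coord a := by
  have h : ∃ b : A, b.1 ∈ φ.dom ∧ π b = π a := ⟨a, ha, rfl⟩
  rw [toFun, dif_pos h]
  exact φ.coord_eq _ _ h.choose_spec.1 ha h.choose_spec.2

open Classical in
/-- The point of the quotient with given coordinates. -/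
noncomputable def invFun (φ : SmoothSlice E π) (a₀ : A) (t : E) : X :=
  -- On `codom` the first case always holds; `a₀` only supplies a value elsewhere.
  if h : φ.param t ∈ A then π ⟨φ.param t, h⟩ else π a₀

theorem invFun_eq (φ : SmoothSlice E π) (a₀ : A) {t : E} (ht : t ∈ φ.codom) :
    φ.invFun a₀ t = π ⟨φ.param t, φ.param_mem t ht⟩ :=
  dif_pos (φ.param_mem t ht)

theorem invFun_coord (φ : SmoothSlice E π) (a₀ : A) {a : A} (ha : a.1 ∈ φ.dom) :
    φ.invFun a₀ (φ.coord a) = π a := by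
  rw [invFun_eq φ a₀ (φ.coord_mem a ha), φ.proj_param_coord a ha]

end SmoothSlice

variable [TopologicalSpace X] [TopologicalSpace Y]

/-- Locally `Ψ ∘ π` is `π'` after a continuous lift, and continuity descends along the quotient map
`π`. -/
theorem LiftsSmoothly.continuous {π : A → X} {π' : B → Y} {Ψ : X → Y}
    (hΨ : LiftsSmoothly π π' Ψ) (hπ : IsQuotientMap π) (hπ' : Continuous π') :
    Continuous Ψ := by
  rw [hπ.continuous_iff, continuous_iff_continuousAt]
  intro a
  obtain ⟨W, hW, haW, G, hG, hGπ⟩ := hΨ a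
  have hO : IsOpen ((↑) ⁻¹' W : Set A) := hW.preimage continuous_subtype_val
  refine ContinuousOn.continuousAt (s := (↑) ⁻¹' W) ?_ (hO.mem_nhds haW)
  rw [continuousOn_iff_continuous_domRestrict]
  have hc : Continuous fun b : ((↑) ⁻¹' W : Set A) => G b.1.1 :=
    hG.continuousOn.comp_continuous (by fun_prop) fun b => b.2
  have h : ((↑) ⁻¹' W : Set A).domRestrict (Ψ ∘ π) =
      fun b => π' ⟨G b.1.1, (hGπ b.1 b.2).1⟩ := by
    funext b
    exact (hGπ b.1 b.2).2.symm
  rw [h]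
  exact hπ'.comp (hc.subtype_mk _)

/-- If `a` is equivalent to a point of the open set `O`, a symmetry moving `a` to that point moves a
whole neighbourhood of `a` into `O`. So the saturation of `O` is open. -/
theorem HasSmoothSymmetries.isOpenMap {π : A → X} (hG : HasSmoothSymmetries π)
    (hπ : IsQuotientMap π) : IsOpenMap π := by
  intro O hO
  rw [← hπ.isOpen_preimage, isOpen_iff_mem_nhds]
  rintro a ⟨a', ha', h⟩
  obtain ⟨G, hGs, hGa, hGb⟩ := hG a a' h.symm
  have hc : Continuous fun b : A => (⟨G b, (hGb b).1⟩ : A) :=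
    (hGs.continuous.comp continuous_subtype_val).subtype_mk _
  have ha : (⟨G a, (hGb a).1⟩ : A) ∈ O := by
    have : (⟨G a, (hGb a).1⟩ : A) = a' := Subtype.ext hGa
    rwa [this]
  filter_upwards [(hO.preimage hc).mem_nhds ha] with b hb
  exact ⟨_, hb, (hGb b).2⟩

namespace SmoothSlice

variable {E : Type} [NormedAddCommGroup E] [NormedSpace ℝ E] {π : A → X}

/-- The chart of the quotient given by a slice. -/
noncomputable def chart (φ : SmoothSlice E π) (a₀ : A) (hπ : IsQuotientMap π)
    (ho : IsOpenMap π) : OpenPartialHomeomorph X E where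
  toFun := φ.toFun
  invFun := φ.invFun a₀
  source := π '' ((↑) ⁻¹' φ.dom)
  target := φ.codom
  map_source' := by
    rintro _ ⟨a, ha, rfl⟩
    rw [φ.toFun_proj ha]
    exact φ.coord_mem a ha
  map_target' := fun t ht => by
    rw [φ.invFun_eq a₀ ht]
    exact ⟨_, φ.param_mem_dom t ht, rfl⟩
  left_inv' := by
    rintro _ ⟨a, ha, rfl⟩
    rw [φ.toFun_proj ha, φ.invFun_coord a₀ ha]
  right_inv' := fun t ht => by
    rw [φ.invFun_eq a₀ ht, φ.toFun_proj (φ.param_mem_dom t ht), φ.coord_param t ht]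
  open_source := ho _ (φ.isOpen_dom.preimage continuous_subtype_val)
  open_target := φ.isOpen_codom
  continuousOn_toFun := by
    rintro _ ⟨a, ha, rfl⟩
    refine ContinuousAt.continuousWithinAt ?_
    -- As `π` is open, continuity at `π a` can be tested upstairs, where the chart is `coord`.
    have hn : 𝓝 (π a) ≤ map π (𝓝 a) := ho.nhds_le a
    refine Tendsto.mono_left ?_ hn
    rw [tendsto_map'_iff, φ.toFun_proj ha]
    have hO : ((↑) ⁻¹' φ.dom : Set A) ∈ 𝓝 a :=
      (φ.isOpen_dom.preimage continuous_subtype_val).mem_nhds ha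
    refine Tendsto.congr' (f₁ := fun b : A => φ.coord b) ?_ ?_
    · filter_upwards [hO] with b hb
      exact (φ.toFun_proj hb).symm
    · exact (φ.contDiffOn_coord.continuousOn.continuousAt
        (φ.isOpen_dom.mem_nhds ha)).comp continuous_subtype_val.continuousAt
  continuousOn_invFun := by
    rw [continuousOn_iff_continuous_domRestrict]
    have h : φ.codom.domRestrict (φ.invFun a₀) =
        fun t : φ.codom => π ⟨φ.param t, φ.param_mem t.1 t.2⟩ := by
      funext t
      exact φ.invFun_eq a₀ t.2
    rw [h]
    exact hπ.continuous.comp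
      ((φ.contDiffOn_param.continuousOn.comp_continuous continuous_subtype_val
        fun t => t.2).subtype_mk _)

/-- The point `φ.param t` need not lie in `ψ.dom`; only some equivalent point does. A symmetry `G`
moves the former to the latter, so the transition is `ψ.coord ∘ G ∘ φ.param` near `t`. -/
theorem contDiffOn_transition (φ ψ : SmoothSlice E π) (a b : A) (hπ : IsQuotientMap π)
    (hG : HasSmoothSymmetries π) :
    ContDiffOn ℝ ∞ ((φ.chart a hπ (hG.isOpenMap hπ)).symm.trans
        (ψ.chart b hπ (hG.isOpenMap hπ)))
      ((φ.chart a hπ (hG.isOpenMap hπ)).symm.trans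
        (ψ.chart b hπ (hG.isOpenMap hπ))).source := by
  rintro t ⟨ht, c, hc, hct⟩
  change t ∈ φ.codom at ht
  change π c = φ.invFun a t at hct
  change ContDiffWithinAt ℝ ∞ (ψ.toFun ∘ φ.invFun a) _ t
  rw [φ.invFun_eq a ht] at hct
  obtain ⟨G, hGs, hGc, hGb⟩ := hG _ _ hct.symm
  have hp : ContDiffAt ℝ ∞ φ.param t :=
    φ.contDiffOn_param.contDiffAt (φ.isOpen_codom.mem_nhds ht)
  have hGp : ContDiffAt ℝ ∞ (G ∘ φ.param) t := hGs.contDiffAt.comp t hp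
  have hdom : G (φ.param t) ∈ ψ.dom := by
    have : G (φ.param t) = c := hGc
    rw [this]
    exact hc
  refine ContDiffAt.contDiffWithinAt ?_
  refine ContDiffAt.congr_of_eventuallyEq (f := ψ.coord ∘ G ∘ φ.param) ?_ ?_
  · exact (ψ.contDiffOn_coord.contDiffAt (ψ.isOpen_dom.mem_nhds hdom)).comp t hGp
  · filter_upwards [φ.isOpen_codom.mem_nhds ht,
      hGp.continuousAt.preimage_mem_nhds (ψ.isOpen_dom.mem_nhds hdom)] with t' ht' htd
    have h := hGb ⟨φ.param t', φ.param_mem t' ht'⟩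
    rw [Function.comp_apply, φ.invFun_eq a ht', ← h.2, ψ.toFun_proj (a := ⟨_, h.1⟩) htd]
    rfl

end SmoothSlice

/-- A quotient with smooth symmetries and with a slice at every point has a natural smooth
structure. -/
theorem exists_isNaturalSmoothStructure {d : ℕ} {π : A → X} (hπ : IsQuotientMap π)
    (hG : HasSmoothSymmetries π)
    (hφ : ∀ a : A, ∃ φ : SmoothSlice (EuclideanSpace ℝ (Fin d)) π, a.1 ∈ φ.dom) :
    ∃ _ : ChartedSpace (EuclideanSpace ℝ (Fin d)) X, IsNaturalSmoothStructure d π := by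
  choose φ hφ using hφ
  have ho := hG.isOpenMap hπ
  let e : A → OpenPartialHomeomorph X (EuclideanSpace ℝ (Fin d)) :=
    fun a => (φ a).chart a hπ ho
  let rep : X → A := Function.surjInv hπ.surjective
  have hrep : ∀ x, π (rep x) = x := Function.surjInv_eq hπ.surjective
  let C : ChartedSpace (EuclideanSpace ℝ (Fin d)) X :=
    { atlas := range e
      chartAt := fun x => e (rep x)
      mem_chart_source := fun x => ⟨rep x, hφ _, hrep x⟩
      chart_mem_atlas := fun x => mem_range_self _ }
  refine ⟨C, ?_⟩
  have hM : IsManifold (𝓡 d) ∞ X := by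
    refine isManifold_of_contDiffOn (𝓡 d) ∞ X ?_
    rintro _ _ ⟨a, rfl⟩ ⟨b, rfl⟩
    simpa using (φ a).contDiffOn_transition (φ b) a b hπ hG
  refine ⟨hM, fun U hU f => ⟨fun hf a ha => ?_, fun hf x hx => ?_⟩⟩
  -- The chart expression of `f` composed with `coord`, which is defined on an ambient open set,
  -- extends the pullback.
  · have hea : e a ∈ IsManifold.maximalAtlas (𝓡 d) ∞ X :=
      IsManifold.subset_maximalAtlas (mem_range_self a)
    have hO : IsOpen ((φ a).codom ∩ (e a).symm ⁻¹' U) :=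
      (e a).isOpen_inter_preimage_symm hU
    have hs : ContDiffOn ℝ ∞ (f ∘ (e a).symm) ((φ a).codom ∩ (e a).symm ⁻¹' U) := by
      rw [← contMDiffOn_iff_contDiffOn]
      exact hf.comp ((contMDiffOn_symm_of_mem_maximalAtlas hea).mono inter_subset_left)
        fun _ h => h.2
    refine ⟨(φ a).dom ∩ (φ a).coord ⁻¹' ((φ a).codom ∩ (e a).symm ⁻¹' U),
      (φ a).contDiffOn_coord.continuousOn.isOpen_inter_preimage (φ a).isOpen_dom hO,
      ⟨hφ a, (φ a).coord_mem a (hφ a), ?_⟩, (f ∘ (e a).symm) ∘ (φ a).coord,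
      hs.comp ((φ a).contDiffOn_coord.mono inter_subset_left) fun _ h => h.2,
      fun b hb => ?_⟩
    · change (φ a).invFun a ((φ a).coord a) ∈ U
      rwa [(φ a).invFun_coord a (hφ a)]
    · change f (π b) = f ((φ a).invFun a ((φ a).coord b))
      rw [(φ a).invFun_coord a hb.1]
  · obtain ⟨a, rfl⟩ := hπ.surjective x
    have hea : e a ∈ IsManifold.maximalAtlas (𝓡 d) ∞ X :=
      IsManifold.subset_maximalAtlas (mem_range_self a)
    have hsrc : π a ∈ (e a).source := ⟨a, hφ a, rfl⟩
    have hpc := (φ a).proj_param_coord a (hφ a)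
    have hmem := (φ a).coord_mem a (hφ a)
    -- The local extension is taken at the point of the slice equivalent to `a`, so that near `π a`
    -- the function `f` is `g ∘ param` read in the chart.
    obtain ⟨W, hW, haW, g, hg, hfg⟩ := hf ⟨_, (φ a).param_mem _ hmem⟩ (by rwa [hpc])
    have hp : ContDiffAt ℝ ∞ (φ a).param ((φ a).coord a) :=
      (φ a).contDiffOn_param.contDiffAt ((φ a).isOpen_codom.mem_nhds hmem)
    have hgp : ContDiffAt ℝ ∞ (g ∘ (φ a).param) ((φ a).coord a) :=
      ContDiffAt.comp ((φ a).coord a) (hg.contDiffAt (hW.mem_nhds haW)) hp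
    have hs : ContMDiffAt (𝓡 d) 𝓘(ℝ, ℝ) ∞ ((g ∘ (φ a).param) ∘ e a) (π a) := by
      refine ContMDiffAt.comp (π a) ?_ (contMDiffAt_of_mem_maximalAtlas hea hsrc)
      have : e a (π a) = (φ a).coord a := (φ a).toFun_proj (hφ a)
      rw [this]
      exact hgp.contMDiffAt
    refine ContMDiffAt.contMDiffWithinAt (hs.congr_of_eventuallyEq ?_)
    have hc : Tendsto (e a) (𝓝 (π a)) (𝓝 ((φ a).coord a)) := by
      have := (e a).continuousAt hsrc
      rwa [ContinuousAt, show e a (π a) = (φ a).coord a from (φ a).toFun_proj (hφ a)] at this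
    filter_upwards [(e a).open_source.mem_nhds hsrc,
      hc (hp.continuousAt.preimage_mem_nhds (hW.mem_nhds haW))] with y hy hyW
    have ht : e a y ∈ (φ a).codom := (e a).map_source hy
    have h := hfg ⟨_, (φ a).param_mem _ ht⟩ hyW
    rw [← (φ a).invFun_eq a ht] at h
    rw [← show (φ a).invFun a (e a y) = y from (e a).left_inv hy]
    rw [h]
    change g ((φ a).param (e a y)) = g ((φ a).param (e a ((e a).symm (e a y))))
    rw [(e a).left_inv hy]

/-- A map of naturally smooth quotients with local smooth lifts is smooth. -/
theorem LiftsSmoothly.contMDiff {d k : ℕ} [ChartedSpace (EuclideanSpace ℝ (Fin d)) X]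
    [ChartedSpace (EuclideanSpace ℝ (Fin k)) Y] {π : A → X} {π' : B → Y} {Ψ : X → Y}
    (hΨ : LiftsSmoothly π π' Ψ) (hX : IsNaturalSmoothStructure d π)
    (hY : IsNaturalSmoothStructure k π') (hπ : IsQuotientMap π) (hπ' : Continuous π') :
    ContMDiff (𝓡 d) (𝓡 k) ∞ Ψ := by
  have := hX.isManifold
  have := hY.isManifold
  have hc := hΨ.continuous hπ hπ'
  intro x
  rw [contMDiffAt_iff_target]
  refine ⟨hc.continuousAt, ?_⟩
  -- Each chart coordinate of `Y` is a smooth real function on the chart domain, so naturality on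
  -- both sides makes its composite with `Ψ` smooth.
  have key : ∀ i, ContMDiffAt (𝓡 d) 𝓘(ℝ, ℝ) ∞
      (fun z => extChartAt (𝓡 k) (Ψ x) (Ψ z) i) x := by
    intro i
    have hUo : IsOpen (chartAt (EuclideanSpace ℝ (Fin k)) (Ψ x)).source :=
      (chartAt _ _).open_source
    have h1 : ContMDiffOn (𝓡 k) 𝓘(ℝ, ℝ) ∞ (fun y => extChartAt (𝓡 k) (Ψ x) y i)
        (chartAt (EuclideanSpace ℝ (Fin k)) (Ψ x)).source :=
      (EuclideanSpace.proj (𝕜 := ℝ) i).contMDiff.comp_contMDiffOn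
        (contMDiffOn_extChartAt (I := 𝓡 k) (x := Ψ x))
    have h2 : SmoothPullbackOn π' _ _ := (hY.smooth_iff _ hUo _).1 h1
    have h3 := (hX.smooth_iff _ (hUo.preimage hc) _).2 (h2.comp hΨ)
    exact h3.contMDiffAt ((hUo.preimage hc).mem_nhds (mem_chart_source _ (Ψ x)))
  have h4 : ContMDiffAt (𝓡 d) 𝓘(ℝ, Fin k → ℝ) ∞
      (fun z i => extChartAt (𝓡 k) (Ψ x) (Ψ z) i) x := contMDiffAt_pi_space.2 key
  exact (EuclideanSpace.equiv (Fin k) ℝ).symm.contDiff.contMDiff.contMDiffAt.comp x h4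

end NaturalStructures

/-! ### Stereographic coordinates on the unit circle -/

section Stereographic

theorem re_ofReal_add_mul_I (x y : ℝ) : ((x : ℂ) + (y : ℂ) * Complex.I).re = x := by simp

theorem im_ofReal_add_mul_I (x y : ℝ) : ((x : ℂ) + (y : ℂ) * Complex.I).im = y := by simp

/-- Stereographic projection of the unit circle from `-a`. -/
noncomputable def stereo (a z : ℂ) : ℝ :=
  (z * starRingEnd ℂ a).im / (1 + (z * starRingEnd ℂ a).re)

/-- The inverse of the stereographic projection from `-a`. -/
noncomputable def stereoInv (a : ℂ) (t : ℝ) : ℂ :=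
  a * (((1 - t ^ 2) / (1 + t ^ 2) : ℝ) + (2 * t / (1 + t ^ 2) : ℝ) * Complex.I)

theorem norm_stereoInv {a : ℂ} (ha : ‖a‖ = 1) (t : ℝ) : ‖stereoInv a t‖ = 1 := by
  have h : (1 + t ^ 2 : ℝ) ≠ 0 := by positivity
  rw [stereoInv, norm_mul, ha, one_mul, Complex.norm_add_mul_I, Real.sqrt_eq_one]
  field_simp
  ring

theorem mul_conj_of_norm_eq_one {a : ℂ} (ha : ‖a‖ = 1) : a * starRingEnd ℂ a = 1 := by
  rw [Complex.mul_conj, Complex.normSq_eq_norm_sq, ha]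
  simp

theorem stereoInv_mul_conj {a : ℂ} (ha : ‖a‖ = 1) (t : ℝ) :
    stereoInv a t * starRingEnd ℂ a =
      ((1 - t ^ 2) / (1 + t ^ 2) : ℝ) + (2 * t / (1 + t ^ 2) : ℝ) * Complex.I := by
  rw [stereoInv, mul_right_comm, mul_conj_of_norm_eq_one ha, one_mul]

theorem one_add_re_stereoInv_pos {a : ℂ} (ha : ‖a‖ = 1) (t : ℝ) :
    0 < 1 + (stereoInv a t * starRingEnd ℂ a).re := by
  rw [stereoInv_mul_conj ha, re_ofReal_add_mul_I]
  have h : (1 + t ^ 2 : ℝ) ≠ 0 := by positivity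
  have : 1 + (1 - t ^ 2) / (1 + t ^ 2) = 2 / (1 + t ^ 2) := by field_simp; ring
  rw [this]
  positivity

theorem stereo_stereoInv {a : ℂ} (ha : ‖a‖ = 1) (t : ℝ) : stereo a (stereoInv a t) = t := by
  rw [stereo, stereoInv_mul_conj ha]
  have h : (1 + t ^ 2 : ℝ) ≠ 0 := by positivity
  rw [re_ofReal_add_mul_I, im_ofReal_add_mul_I]
  field_simp
  ring

/-- The coordinate is the tangent `t` of half the angle from `a` to `z`, and `1 + t² = 2 / (1 +
cos)`. The positivity hypothesis excludes the antipode `-a`. -/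
theorem stereoInv_stereo {a z : ℂ} (ha : ‖a‖ = 1) (hz : ‖z‖ = 1)
    (h : 0 < 1 + (z * starRingEnd ℂ a).re) : stereoInv a (stereo a z) = z := by
  set u := z * starRingEnd ℂ a with hu
  have hz' : z = a * u := by
    rw [hu, mul_left_comm, mul_conj_of_norm_eq_one ha, mul_one]
  have hun : u.re ^ 2 + u.im ^ 2 = 1 := by
    have : ‖u‖ = 1 := by rw [hu, norm_mul, hz, RCLike.norm_conj, ha, one_mul]
    rw [← Complex.normSq_add_mul_I, Complex.re_add_im, Complex.normSq_eq_norm_sq, this, one_pow]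
  have hs : stereo a z = u.im / (1 + u.re) := rfl
  have h0 : 1 + u.re ≠ 0 := h.ne'
  have hden : 1 + (u.im / (1 + u.re)) ^ 2 = 2 / (1 + u.re) := by
    field_simp
    linear_combination hun
  rw [stereoInv, hs, hden, hz']
  congr 1
  apply Complex.ext
  · rw [re_ofReal_add_mul_I]
    field_simp
    linear_combination -hun
  · rw [im_ofReal_add_mul_I]
    field_simp

theorem contDiff_stereoInv (a : ℂ) : ContDiff ℝ ∞ (stereoInv a) := by
  unfold stereoInv
  have h : ∀ t : ℝ, 1 + t ^ 2 ≠ 0 := fun t => by positivity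
  have h1 : ContDiff ℝ ∞ fun t : ℝ => (1 - t ^ 2) / (1 + t ^ 2) :=
    ContDiff.div (by fun_prop) (by fun_prop) h
  have h2 : ContDiff ℝ ∞ fun t : ℝ => 2 * t / (1 + t ^ 2) :=
    ContDiff.div (by fun_prop) (by fun_prop) h
  exact contDiff_const.mul ((Complex.ofRealCLM.contDiff.comp h1).add
    ((Complex.ofRealCLM.contDiff.comp h2).mul contDiff_const))

theorem contDiff_re_mul_const (a : ℂ) : ContDiff ℝ ∞ fun z : ℂ => (z * a).re :=
  Complex.reCLM.contDiff.comp (contDiff_id.mul contDiff_const)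

theorem contDiffOn_stereo (a : ℂ) :
    ContDiffOn ℝ ∞ (stereo a) {z | 0 < 1 + (z * starRingEnd ℂ a).re} := by
  unfold stereo
  exact ContDiffOn.div (Complex.imCLM.contDiff.comp (contDiff_id.mul contDiff_const)).contDiffOn
    (contDiff_const.add (contDiff_re_mul_const _)).contDiffOn fun z hz => ne_of_gt hz

end Stereographic

/-! ### Slices of the chain space -/

section Chains

theorem norm_sq_eq_re_sq_add_im_sq (z : ℂ) : ‖z‖ ^ 2 = z.re ^ 2 + z.im ^ 2 := by
  rw [← Complex.normSq_eq_norm_sq, Complex.normSq_apply]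
  ring

theorem chainEnd_re {n : ℕ} (α : Fin (n + 1) → ℝ) (v : Fin n → ℂ) :
    (chainEnd α v).re = ∑ i, α i.castSucc * (v i).re := by
  simp [chainEnd]

theorem chainEnd_conj {n : ℕ} (α : Fin (n + 1) → ℝ) (v : Fin n → ℂ) :
    chainEnd α (fun i => starRingEnd ℂ (v i)) = starRingEnd ℂ (chainEnd α v) := by
  simp [chainEnd]

theorem chainSpace_mk_eq_iff {n : ℕ} {α : Fin (n + 1) → ℝ} {u v : chainSet α} :
    ChainSpace.mk α u = ChainSpace.mk α v ↔
      u = v ∨ ∀ i, u.1 i = starRingEnd ℂ (v.1 i) :=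
  Quotient.eq

theorem isQuotientMap_chainSpace_mk {n : ℕ} (α : Fin (n + 1) → ℝ) :
    IsQuotientMap (ChainSpace.mk α) :=
  isQuotientMap_quotient_mk'

theorem conj_mem_chainSet {n : ℕ} {α : Fin (n + 1) → ℝ} {v : Fin n → ℂ} (hv : v ∈ chainSet α) :
    (fun i => starRingEnd ℂ (v i)) ∈ chainSet α :=
  ⟨fun i => by rw [RCLike.norm_conj, hv.1 i], by rw [chainEnd_conj, Complex.conj_re, hv.2]⟩

theorem hasSmoothSymmetries_chainSpace {n : ℕ} (α : Fin (n + 1) → ℝ) :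
    HasSmoothSymmetries (ChainSpace.mk α) := by
  intro a a' h
  rcases chainSpace_mk_eq_iff.1 h with rfl | h
  · exact ⟨id, contDiff_id, rfl, fun b => ⟨b.2, rfl⟩⟩
  · refine ⟨fun v i => starRingEnd ℂ (v i), ?_, ?_, fun b => ⟨conj_mem_chainSet b.2, ?_⟩⟩
    · exact contDiff_pi.2 fun i => Complex.conjCLE.contDiff.comp (contDiff_apply ℝ ℂ i)
    · funext i
      simp [h i]
    · exact chainSpace_mk_eq_iff.2 (Or.inr fun i => rfl)

/-- A chain for a generic length vector does not lie on the `X`-axis. -/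
theorem exists_im_ne_zero {n : ℕ} {α : Fin (n + 1) → ℝ} (hgen : IsGeneric α) (v : chainSet α) :
    ∃ j, (v.1 j).im ≠ 0 := by
  by_contra! h
  -- If all sides are horizontal, their abscissas are signs, and with `-1` for the last length they
  -- form a vanishing signed sum.
  refine hgen (Fin.snoc (α := fun _ => ℝ) (fun i => (v.1 i).re) (-1)) (fun i => ?_) ?_
  · refine Fin.lastCases ?_ (fun i => ?_) i
    · simp
    · have h1 := norm_sq_eq_re_sq_add_im_sq (v.1 i)
      rw [v.2.1 i, h i] at h1
      rw [Fin.snoc_castSucc]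
      exact sq_eq_one_iff.1 (by linarith)
  · have h1 := v.2.2
    rw [chainEnd_re] at h1
    rw [Fin.sum_univ_castSucc]
    simp only [Fin.snoc_castSucc, Fin.snoc_last]
    rw [← h1, neg_one_mul, ← sub_eq_add_neg, sub_eq_zero]
    exact Finset.sum_congr rfl fun i _ => mul_comm _ _

/-- The abscissa of the `j`-th side of a chain, in terms of the other sides. -/
noncomputable def missingCos {k : ℕ} (α : Fin (k + 2) → ℝ) (j : Fin (k + 1)) (u : Fin k → ℂ) : ℝ :=
  (α (Fin.last (k + 1)) - ∑ i, α (j.succAbove i).castSucc * (u i).re) / α j.castSucc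

theorem contDiff_missingCos {k : ℕ} (α : Fin (k + 2) → ℝ) (j : Fin (k + 1)) :
    ContDiff ℝ ∞ (missingCos α j) := by
  unfold missingCos
  refine (contDiff_const.sub (ContDiff.sum fun i _ => ?_)).div_const _
  exact contDiff_const.mul (Complex.reCLM.contDiff.comp (contDiff_apply ℝ ℂ i))

theorem chainEnd_re_eq_iff {k : ℕ} {α : Fin (k + 2) → ℝ} {j : Fin (k + 1)}
    (hj : α j.castSucc ≠ 0) (v : Fin (k + 1) → ℂ) :
    (chainEnd α v).re = α (Fin.last (k + 1)) ↔
      (v j).re = missingCos α j fun i => v (j.succAbove i) := by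
  rw [chainEnd_re, Fin.sum_univ_succAbove _ j, missingCos, eq_div_iff hj]
  constructor <;> intro h <;> linarith

/-- The slice of the chain space at a chain `a` whose `j`-th side is not horizontal: the
stereographic coordinates of the other sides. -/
noncomputable def chainSlice {k : ℕ} (α : Fin (k + 2) → ℝ) (j : Fin (k + 1)) (hj : 0 < α j.castSucc)
    (a : chainSet α) (σ : ℝ) (hσ : σ ^ 2 = 1) :
    SmoothSlice (EuclideanSpace ℝ (Fin k)) (ChainSpace.mk α) := by
  have hcoord : ∀ v : chainSet α, (v.1 j).re = missingCos α j fun i => v.1 (j.succAbove i) :=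
    fun v => (chainEnd_re_eq_iff hj.ne' v.1).1 v.2.2
  let c : EuclideanSpace ℝ (Fin k) → ℝ := fun t =>
    missingCos α j fun i => stereoInv (a.1 (j.succAbove i)) (t i)
  have hc : ContDiff ℝ ∞ c := (contDiff_missingCos α j).comp <| contDiff_pi.2 fun i =>
    (contDiff_stereoInv _).comp (EuclideanSpace.proj (𝕜 := ℝ) i).contDiff
  let coord : (Fin (k + 1) → ℂ) → EuclideanSpace ℝ (Fin k) := fun v =>
    WithLp.toLp 2 fun i => stereo (a.1 (j.succAbove i)) (v (j.succAbove i))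
  let param : EuclideanSpace ℝ (Fin k) → Fin (k + 1) → ℂ := fun t =>
    Fin.insertNth (α := fun _ => ℂ) j (c t + (σ * √(1 - c t ^ 2) : ℝ) * Complex.I)
      fun i => stereoInv (a.1 (j.succAbove i)) (t i)
  -- Conjugation flips the sign of the `j`-th ordinate, so the first condition admits at most one
  -- chain of each mirror pair. It also tells which square root recovers that side from its
  -- abscissa.
  let dom : Set (Fin (k + 1) → ℂ) := {v | 0 < σ * (v j).im ∧
    ∀ i, 0 < 1 + (v (j.succAbove i) * starRingEnd ℂ (a.1 (j.succAbove i))).re}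
  have hparam_j : ∀ t, param t j = c t + (σ * √(1 - c t ^ 2) : ℝ) * Complex.I := fun t =>
    Fin.insertNth_apply_same ..
  have hparam : ∀ t i, param t (j.succAbove i) = stereoInv (a.1 (j.succAbove i)) (t i) :=
    fun t i => Fin.insertNth_apply_succAbove ..
  have hparam_re : ∀ t, (param t j).re = c t := fun t => by
    rw [hparam_j, re_ofReal_add_mul_I]
  have hparam_im : ∀ t, (param t j).im = σ * √(1 - c t ^ 2) := fun t => by
    rw [hparam_j, im_ofReal_add_mul_I]
  have hcc : ∀ v : chainSet α, v.1 ∈ dom → c (coord v) = (v.1 j).re := fun v hv => by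
    rw [hcoord v]
    change missingCos α j _ = _
    congr 1
    funext i
    exact stereoInv_stereo (a.2.1 _) (v.2.1 _) (hv.2 i)
  have hpc : ∀ v : chainSet α, v.1 ∈ dom → param (coord v) = v.1 := fun v hv => by
    funext l
    obtain rfl | ⟨i, rfl⟩ := Fin.eq_self_or_eq_succAbove j l
    · apply Complex.ext
      · rw [hparam_re, hcc v hv]
      · rw [hparam_im, hcc v hv]
        have h1 := norm_sq_eq_re_sq_add_im_sq (v.1 l)
        rw [v.2.1] at h1
        have h2 : 1 - (v.1 l).re ^ 2 = (σ * (v.1 l).im) ^ 2 := by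
          rw [mul_pow, hσ]
          linarith
        rw [h2, Real.sqrt_sq hv.1.le, ← mul_assoc, ← sq, hσ, one_mul]
    · rw [hparam]
      exact stereoInv_stereo (a.2.1 _) (v.2.1 _) (hv.2 i)
  exact
  { dom := dom
    codom := {t | c t ^ 2 < 1}
    coord := coord
    param := param
    isOpen_dom := by
      have h : dom = {v | 0 < σ * (v j).im} ∩ ⋂ i,
          {v | 0 < 1 + (v (j.succAbove i) * starRingEnd ℂ (a.1 (j.succAbove i))).re} := by
        ext v
        simp [dom]
      rw [h]
      exact (isOpen_lt continuous_const (continuous_const.mul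
        (Complex.continuous_im.comp (continuous_apply j)))).inter
        (isOpen_iInter_of_finite fun i => isOpen_lt continuous_const (continuous_const.add
          ((contDiff_re_mul_const _).continuous.comp (continuous_apply _))))
    isOpen_codom := isOpen_lt (hc.continuous.pow 2) continuous_const
    contDiffOn_coord := by
      refine (EuclideanSpace.equiv (Fin k) ℝ).symm.contDiff.comp_contDiffOn
        (contDiffOn_pi.2 fun i => ?_)
      exact (contDiffOn_stereo _).comp (contDiff_apply ℝ ℂ (j.succAbove i)).contDiffOn
        fun v hv => hv.2 i
    contDiffOn_param := by
      refine contDiffOn_pi.2 fun l => ?_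
      obtain rfl | ⟨i, rfl⟩ := Fin.eq_self_or_eq_succAbove j l
      · simp only [hparam_j]
        have h1 : ContDiffOn ℝ ∞ (fun t => √(1 - c t ^ 2)) {t | c t ^ 2 < 1} :=
          (contDiff_const.sub (hc.pow 2)).contDiffOn.sqrt fun t ht => (sub_pos.2 ht).ne'
        exact (Complex.ofRealCLM.contDiff.comp hc).contDiffOn.add
          ((Complex.ofRealCLM.contDiff.comp_contDiffOn (contDiffOn_const.mul h1)).mul
            contDiffOn_const)
      · simp only [hparam]
        exact ((contDiff_stereoInv _).comp (EuclideanSpace.proj (𝕜 := ℝ) i).contDiff).contDiffOn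
    coord_mem := fun v hv => by
      change c (coord v) ^ 2 < 1
      rw [hcc v hv]
      have h1 := norm_sq_eq_re_sq_add_im_sq (v.1 j)
      rw [v.2.1] at h1
      have h2 : (v.1 j).im ≠ 0 := right_ne_zero_of_mul hv.1.ne'
      have := pow_pos (abs_pos.2 h2) 2
      rw [sq_abs] at this
      linarith
    param_mem := fun t ht => by
      refine ⟨fun l => ?_, ?_⟩
      · obtain rfl | ⟨i, rfl⟩ := Fin.eq_self_or_eq_succAbove j l
        · rw [← sq_eq_sq₀ (norm_nonneg _) zero_le_one, norm_sq_eq_re_sq_add_im_sq, hparam_re,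
            hparam_im, mul_pow, hσ, Real.sq_sqrt (sub_pos.2 ht).le]
          ring
        · rw [hparam]
          exact norm_stereoInv (a.2.1 _) _
      · rw [chainEnd_re_eq_iff hj.ne', hparam_re]
        simp only [hparam]
        rfl
    param_mem_dom := fun t ht => by
      refine ⟨?_, fun i => ?_⟩
      · rw [hparam_im, ← mul_assoc, ← sq, hσ, one_mul]
        exact Real.sqrt_pos.2 (sub_pos.2 ht)
      · rw [hparam]
        exact one_add_re_stereoInv_pos (a.2.1 _) _
    coord_param := fun t ht => by
      ext i
      change stereo _ (param t (j.succAbove i)) = t i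
      rw [hparam, stereo_stereoInv (a.2.1 _)]
    proj_param_coord := fun v hv => congrArg _ (Subtype.ext (hpc v hv))
    coord_eq := fun u v hu hv h => by
      rcases chainSpace_mk_eq_iff.1 h with rfl | h
      · rfl
      · have h1 := hu.1
        rw [h j, Complex.conj_im, mul_neg] at h1
        exact absurd hv.1 (by linarith) }

theorem exists_chainSlice {k : ℕ} {α : Fin (k + 2) → ℝ} (hpos : ∀ i, 0 < α i)
    (hgen : IsGeneric α) (a : chainSet α) :
    ∃ φ : SmoothSlice (EuclideanSpace ℝ (Fin k)) (ChainSpace.mk α), a.1 ∈ φ.dom := by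
  obtain ⟨j, hj⟩ := exists_im_ne_zero hgen a
  have key : ∀ σ : ℝ, ∀ hσ : σ ^ 2 = 1, 0 < σ * (a.1 j).im →
      a.1 ∈ (chainSlice α j (hpos _) a σ hσ).dom := fun σ hσ h => by
    refine ⟨h, fun i => ?_⟩
    rw [mul_conj_of_norm_eq_one (a.2.1 _)]
    norm_num
  rcases lt_or_gt_of_ne hj with h | h
  · exact ⟨_, key (-1) (by norm_num) (by linarith)⟩
  · exact ⟨_, key 1 (by norm_num) (by linarith)⟩

theorem isEmpty_chainSet {α : Fin (0 + 1) → ℝ} (hpos : ∀ i, 0 < α i) : IsEmpty (chainSet α) := by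
  refine ⟨fun v => ?_⟩
  have h := v.2.2
  rw [chainEnd_re, Finset.univ_eq_empty, Finset.sum_empty] at h
  exact (hpos _).ne h

/-- The chain space has a slice at every point, of dimension `n - 1`. -/
theorem exists_slice_chainSpace {n : ℕ} {α : Fin (n + 1) → ℝ} (hpos : ∀ i, 0 < α i)
    (hgen : IsGeneric α) (a : chainSet α) :
    ∃ φ : SmoothSlice (EuclideanSpace ℝ (Fin (n - 1))) (ChainSpace.mk α), a.1 ∈ φ.dom := by
  cases n with
  -- Here `n - 1` is truncated to `0`, harmlessly: an empty sum cannot equal the positive last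
  -- length.
  | zero => exact ((isEmpty_chainSet hpos).false a).elim
  | succ k => exact exists_chainSlice hpos hgen a

end Chains

/-! ### Transfer of slices between quotients -/

section Transfer

variable {V V' X Y : Type} [NormedAddCommGroup V] [NormedSpace ℝ V]
  [NormedAddCommGroup V'] [NormedSpace ℝ V'] {A : Set V} {B : Set V'}

theorem LiftsSmoothly.of_contDiffOn {π : A → X} {π' : B → Y} {Ψ : X → Y} {O : Set V} {G : V → V'}
    (hO : IsOpen O) (hAO : A ⊆ O) (hG : ContDiffOn ℝ ∞ G O)
    (h : ∀ a : A, ∃ hb : G a ∈ B, π' ⟨G a, hb⟩ = Ψ (π a)) : LiftsSmoothly π π' Ψ :=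
  fun a => ⟨O, hO, hAO a.2, G, hG, fun b _ => h b⟩

/-- A slice can be transferred along a smooth map `D : B → A` with a smooth section `C`, which is
an inverse of `D` up to the identifications in the quotients. -/
noncomputable def SmoothSlice.transfer {E : Type} [NormedAddCommGroup E] [NormedSpace ℝ E]
    {π : A → X} (φ : SmoothSlice E π) {π' : B → Y} {O : Set V} {O' : Set V'} {C : V → V'}
    {D : V' → V} (hO' : IsOpen O') (hAO : A ⊆ O) (hBO : B ⊆ O')
    (hC : ContDiffOn ℝ ∞ C O) (hD : ContDiffOn ℝ ∞ D O') (hCA : ∀ a ∈ A, C a ∈ B)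
    (hDB : ∀ b ∈ B, D b ∈ A) (hDC : ∀ a ∈ A, D (C a) = a)
    (hπ : ∀ a a' : A, π a = π a' → π' ⟨C a, hCA a a.2⟩ = π' ⟨C a', hCA a' a'.2⟩)
    (hCD : ∀ b : B, π' ⟨C (D b), hCA _ (hDB b b.2)⟩ = π' b)
    (hπ' : ∀ b b' : B, π' b = π' b' → π ⟨D b, hDB b b.2⟩ = π ⟨D b', hDB b' b'.2⟩) :
    SmoothSlice E π' where
  dom := O' ∩ D ⁻¹' φ.dom
  codom := φ.codom
  coord := φ.coord ∘ D
  param := C ∘ φ.param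
  isOpen_dom := hD.continuousOn.isOpen_inter_preimage hO' φ.isOpen_dom
  isOpen_codom := φ.isOpen_codom
  contDiffOn_coord := φ.contDiffOn_coord.comp (hD.mono inter_subset_left) fun _ h => h.2
  contDiffOn_param := hC.comp φ.contDiffOn_param fun t ht => hAO (φ.param_mem t ht)
  coord_mem := fun b hb => φ.coord_mem ⟨D b, hDB b b.2⟩ hb.2
  param_mem := fun t ht => hCA _ (φ.param_mem t ht)
  param_mem_dom := fun t ht => by
    refine ⟨hBO (hCA _ (φ.param_mem t ht)), ?_⟩
    rw [mem_preimage, Function.comp_apply, hDC _ (φ.param_mem t ht)]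
    exact φ.param_mem_dom t ht
  coord_param := fun t ht => by
    rw [Function.comp_apply, Function.comp_apply, hDC _ (φ.param_mem t ht), φ.coord_param t ht]
  proj_param_coord := fun b hb => by
    rw [← hCD b]
    exact hπ ⟨_, _⟩ ⟨D b, hDB b b.2⟩ (φ.proj_param_coord ⟨D b, hDB b b.2⟩ hb.2)
  coord_eq := fun b b' hb hb' h =>
    φ.coord_eq ⟨D b, hDB b b.2⟩ ⟨D b', hDB b' b'.2⟩ hb.2 hb'.2 (hπ' b b' h)

end Transfer

/-! ### The closing triangle and its inverse construction -/

section Triangle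

/-- The determinant of two plane vectors. -/
noncomputable def planeDet (p w : ℂ) : ℝ := p.re * w.im - p.im * w.re

/-- The scalar product of two plane vectors. -/
noncomputable def planeDot (p w : ℂ) : ℝ := p.re * w.re + p.im * w.im

/-- Scalar product and determinant with `p ≠ 0` together determine `w`, by dividing by the conjugate
of `p`; `closingSide` is defined this way. -/
theorem conj_mul_eq (p w : ℂ) :
    starRingEnd ℂ p * w = planeDot p w + planeDet p w * Complex.I := by
  apply Complex.ext
  · rw [re_ofReal_add_mul_I, Complex.mul_re, Complex.conj_re, Complex.conj_im, planeDot]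
    ring
  · rw [im_ofReal_add_mul_I, Complex.mul_im, Complex.conj_re, Complex.conj_im, planeDet]
    ring

theorem planeDet_eq_im (p w : ℂ) : planeDet p w = (starRingEnd ℂ p * w).im := by
  rw [conj_mul_eq, im_ofReal_add_mul_I]

theorem planeDot_sq_add_planeDet_sq (p w : ℂ) :
    planeDot p w ^ 2 + planeDet p w ^ 2 = Complex.normSq p * Complex.normSq w := by
  rw [planeDot, planeDet, Complex.normSq_apply, Complex.normSq_apply]
  ring

theorem normSq_add_mul (p w : ℂ) (δ : ℝ) : Complex.normSq (p + δ * w) =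
    Complex.normSq p + δ ^ 2 * Complex.normSq w + 2 * δ * planeDot p w := by
  rw [Complex.normSq_apply, Complex.normSq_apply, Complex.normSq_apply, planeDot]
  simp
  ring

theorem normSq_of_norm_eq_one {w : ℂ} (hw : ‖w‖ = 1) : Complex.normSq w = 1 := by
  rw [Complex.normSq_eq_norm_sq, hw, one_pow]

theorem norm_eq_one_of_normSq {w : ℂ} (hw : Complex.normSq w = 1) : ‖w‖ = 1 := by
  rw [Complex.normSq_eq_norm_sq] at hw
  exact (pow_eq_one_iff_of_nonneg (norm_nonneg _) two_ne_zero).1 hw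

/-- For a triangle with sides `p`, `δ w`, `(c + δ) x`, where `|p|² = c² + r`, the square of
`det (p, w)` is `r` times this number. -/
noncomputable def closingDisc (c δ r : ℝ) : ℝ := 1 + c / δ - r / (4 * δ ^ 2)

theorem closingDisc_pos {c δ r : ℝ} (hc : 0 < c) (hδ : 0 < δ) (hr : r < δ ^ 2) :
    0 < closingDisc c δ r := by
  have h1 : r / (4 * δ ^ 2) < 1 := by
    rw [div_lt_one (by positivity)]
    nlinarith [sq_nonneg δ]
  have h2 : 0 < c / δ := by positivity
  rw [closingDisc]
  linarith

variable {c δ s : ℝ} {p w x : ℂ}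

/-- Law of cosines: compare the squared norms of `p + δ w` and `(c + δ) x`. -/
theorem planeDot_of_triangle (hδ : 0 < δ) (hw : ‖w‖ = 1) (hx : ‖x‖ = 1)
    (h : p + δ * w + (c + δ : ℝ) * x = 0) :
    planeDot p w = c - (Complex.normSq p - c ^ 2) / (2 * δ) := by
  have h1 : p + δ * w = -((c + δ : ℝ) * x) := eq_neg_of_add_eq_zero_left h
  have h2 := congrArg Complex.normSq h1
  rw [normSq_add_mul, Complex.normSq_neg, Complex.normSq_mul, Complex.normSq_ofReal,
    normSq_of_norm_eq_one hw, normSq_of_norm_eq_one hx] at h2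
  field_simp
  linarith

/-- Lagrange's identity turns the known scalar product into the squared determinant; the factor
`|p|² - c²` splits off. -/
theorem planeDet_sq_of_triangle (hδ : 0 < δ) (hw : ‖w‖ = 1) (hx : ‖x‖ = 1)
    (h : p + δ * w + (c + δ : ℝ) * x = 0) :
    planeDet p w ^ 2 =
      (Complex.normSq p - c ^ 2) * closingDisc c δ (Complex.normSq p - c ^ 2) := by
  have h1 := planeDot_sq_add_planeDet_sq p w
  rw [planeDot_of_triangle hδ hw hx h, normSq_of_norm_eq_one hw] at h1
  rw [eq_sub_of_add_eq' h1, closingDisc]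
  field_simp
  ring

theorem le_norm_of_triangle (hc : 0 < c) (hδ : 0 < δ) (hw : ‖w‖ = 1) (hx : ‖x‖ = 1)
    (h : p + δ * w + (c + δ : ℝ) * x = 0) : c ≤ ‖p‖ := by
  have h1 : p + δ * w = -((c + δ : ℝ) * x) := eq_neg_of_add_eq_zero_left h
  have h2 := norm_add_le p (δ * w)
  rw [h1, norm_neg, norm_mul, norm_mul, hw, hx, Complex.norm_real, Complex.norm_real,
    Real.norm_of_nonneg hδ.le, Real.norm_of_nonneg (by positivity)] at h2
  linarith

/-- The side `w` of the triangle with sides `p`, `δ w`, `(c + δ) x`, where `c = re p`, on the side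
of `p` prescribed by `s`. -/
noncomputable def closingSide (c δ s : ℝ) (p : ℂ) : ℂ :=
  ((c - p.im ^ 2 / (2 * δ) : ℝ) + (s * p.im * √(closingDisc c δ (p.im ^ 2)) : ℝ) * Complex.I) /
    starRingEnd ℂ p

/-- The remaining side `x` of the triangle with sides `p`, `δ w`, `(c + δ) x`. -/
noncomputable def remainingSide (c δ : ℝ) (p w : ℂ) : ℂ := -(p + δ * w) / (c + δ : ℝ)

theorem add_remainingSide (hcδ : c + δ ≠ 0) :
    p + δ * w + (c + δ : ℝ) * remainingSide c δ p w = 0 := by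
  have h : ((c + δ : ℝ) : ℂ) ≠ 0 := Complex.ofReal_ne_zero.2 hcδ
  rw [remainingSide, mul_div_cancel₀ _ h]
  ring

theorem eq_remainingSide (hcδ : c + δ ≠ 0) (h : p + δ * w + (c + δ : ℝ) * x = 0) :
    x = remainingSide c δ p w := by
  have h0 : ((c + δ : ℝ) : ℂ) ≠ 0 := Complex.ofReal_ne_zero.2 hcδ
  rw [remainingSide, eq_div_iff h0]
  linear_combination h

theorem normSq_eq_of_re (hp : p.re = c) : Complex.normSq p = c ^ 2 + p.im ^ 2 := by
  rw [Complex.normSq_apply, hp]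
  ring

theorem normSq_sub_of_re (hp : p.re = c) : Complex.normSq p - c ^ 2 = p.im ^ 2 := by
  rw [normSq_eq_of_re hp, add_sub_cancel_left]

theorem ne_zero_of_re (hc : 0 < c) (hp : p.re = c) : p ≠ 0 := by
  rintro rfl
  exact hc.ne hp

theorem conj_mul_closingSide (h0 : p ≠ 0) : starRingEnd ℂ p * closingSide c δ s p =
    (c - p.im ^ 2 / (2 * δ) : ℝ) +
      (s * p.im * √(closingDisc c δ (p.im ^ 2)) : ℝ) * Complex.I :=
  mul_div_cancel₀ _ ((map_ne_zero _).2 h0)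

theorem planeDot_closingSide (h0 : p ≠ 0) :
    planeDot p (closingSide c δ s p) = c - p.im ^ 2 / (2 * δ) := by
  have h := conj_mul_closingSide (c := c) (δ := δ) (s := s) h0
  rw [conj_mul_eq] at h
  simpa only [re_ofReal_add_mul_I] using congrArg Complex.re h

theorem planeDet_closingSide (h0 : p ≠ 0) :
    planeDet p (closingSide c δ s p) = s * p.im * √(closingDisc c δ (p.im ^ 2)) := by
  have h := conj_mul_closingSide (c := c) (δ := δ) (s := s) h0
  rw [conj_mul_eq] at h
  simpa only [im_ofReal_add_mul_I] using congrArg Complex.im h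

theorem norm_closingSide (hc : 0 < c) (hδ : 0 < δ) (hs : s ^ 2 = 1) (hp : p.re = c)
    (hd : 0 < closingDisc c δ (p.im ^ 2)) : ‖closingSide c δ s p‖ = 1 := by
  have h0 := ne_zero_of_re hc hp
  refine norm_eq_one_of_normSq (mul_left_cancel₀ (Complex.normSq_pos.2 h0).ne' ?_)
  rw [← planeDot_sq_add_planeDet_sq, planeDot_closingSide h0, planeDet_closingSide h0, mul_pow,
    mul_pow, hs, Real.sq_sqrt hd.le, normSq_eq_of_re hp, closingDisc]
  field_simp
  ring

theorem norm_remainingSide (hc : 0 < c) (hδ : 0 < δ) (hs : s ^ 2 = 1) (hp : p.re = c)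
    (hd : 0 < closingDisc c δ (p.im ^ 2)) :
    ‖remainingSide c δ p (closingSide c δ s p)‖ = 1 := by
  apply norm_eq_one_of_normSq
  rw [remainingSide, Complex.normSq_div, Complex.normSq_neg, normSq_add_mul,
    planeDot_closingSide (ne_zero_of_re hc hp),
    normSq_of_norm_eq_one (norm_closingSide hc hδ hs hp hd), normSq_eq_of_re hp,
    Complex.normSq_ofReal]
  field_simp
  ring

theorem closingSide_side (hc : 0 < c) (hp : p.re = c) :
    0 ≤ s * p.im * planeDet p (closingSide c δ s p) := by
  rw [planeDet_closingSide (ne_zero_of_re hc hp), ← mul_assoc]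
  exact mul_nonneg (mul_self_nonneg _) (Real.sqrt_nonneg _)

/-- The triangle fixes the scalar product and the square of the determinant, and the side condition
fixes the remaining sign. -/
theorem eq_closingSide (hc : 0 < c) (hδ : 0 < δ) (hs : s ^ 2 = 1) (hp : p.re = c)
    (hd : 0 < closingDisc c δ (p.im ^ 2)) (hw : ‖w‖ = 1) (hx : ‖x‖ = 1)
    (h : p + δ * w + (c + δ : ℝ) * x = 0) (hside : 0 ≤ s * p.im * planeDet p w) :
    w = closingSide c δ s p := by
  have hdot := planeDot_of_triangle hδ hw hx h
  have hdet := planeDet_sq_of_triangle hδ hw hx h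
  rw [normSq_sub_of_re hp] at hdot hdet
  have key : planeDet p w = s * p.im * √(closingDisc c δ (p.im ^ 2)) := by
    -- On the axis the triangle is degenerate and the side condition is void, but then the
    -- determinant vanishes anyway.
    rcases eq_or_ne p.im 0 with h0 | h0
    · rw [h0] at hdet ⊢
      simpa using hdet
    · have hK := Real.sq_sqrt hd.le
      have hsq : (s * p.im * planeDet p w) ^ 2 =
          (p.im ^ 2 * √(closingDisc c δ (p.im ^ 2))) ^ 2 := by
        rw [mul_pow, mul_pow, mul_pow, hdet, hK, hs]
        ring
      have h1 := (pow_left_inj₀ hside (by positivity) two_ne_zero).1 hsq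
      refine mul_left_cancel₀ h0 ?_
      linear_combination s * h1 - p.im * planeDet p w * hs
  rw [closingSide, eq_div_iff ((map_ne_zero _).2 (ne_zero_of_re hc hp)), mul_comm, conj_mul_eq,
    hdot, key]

/-- The ordinate, after a rotation, of the end of the side `p` of a triangle with sides `p`, `δ w`,
`(c + δ) x` whose abscissa is `c`. -/
noncomputable def openingHeight (c δ s : ℝ) (p w : ℂ) : ℝ :=
  s * planeDet p w / √(closingDisc c δ (Complex.normSq p - c ^ 2))

/-- The factor which rotates the side `p` so that its abscissa becomes `c`. -/
noncomputable def openingFactor (c δ s : ℝ) (p w : ℂ) : ℂ :=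
  (c + openingHeight c δ s p w * Complex.I) / p

theorem openingHeight_sq (hδ : 0 < δ) (hs : s ^ 2 = 1)
    (hd : 0 < closingDisc c δ (Complex.normSq p - c ^ 2)) (hw : ‖w‖ = 1) (hx : ‖x‖ = 1)
    (h : p + δ * w + (c + δ : ℝ) * x = 0) :
    openingHeight c δ s p w ^ 2 = Complex.normSq p - c ^ 2 := by
  rw [openingHeight, div_pow, mul_pow, hs, one_mul, planeDet_sq_of_triangle hδ hw hx h,
    Real.sq_sqrt hd.le, mul_div_cancel_right₀ _ hd.ne']

theorem openingFactor_mul (h0 : p ≠ 0) :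
    openingFactor c δ s p w * p = c + openingHeight c δ s p w * Complex.I :=
  div_mul_cancel₀ _ h0

theorem norm_openingFactor (h0 : p ≠ 0) (hδ : 0 < δ) (hs : s ^ 2 = 1)
    (hd : 0 < closingDisc c δ (Complex.normSq p - c ^ 2)) (hw : ‖w‖ = 1) (hx : ‖x‖ = 1)
    (h : p + δ * w + (c + δ : ℝ) * x = 0) : ‖openingFactor c δ s p w‖ = 1 := by
  apply norm_eq_one_of_normSq
  rw [openingFactor, Complex.normSq_div, Complex.normSq_add_mul_I,
    openingHeight_sq hδ hs hd hw hx h, add_sub_cancel, div_self (Complex.normSq_pos.2 h0).ne']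

theorem planeDet_mul_mul {μ : ℂ} (hμ : ‖μ‖ = 1) : planeDet (μ * p) (μ * w) = planeDet p w := by
  rw [planeDet_eq_im, planeDet_eq_im, map_mul]
  congr 1
  linear_combination (starRingEnd ℂ p * w) * mul_conj_of_norm_eq_one hμ

theorem planeDet_conj_conj :
    planeDet (starRingEnd ℂ p) (starRingEnd ℂ w) = -planeDet p w := by
  simp only [planeDet, Complex.conj_re, Complex.conj_im]
  ring

/-- The determinant of the closing triangle is `s y √K`, so the height recovered from it is `y` and
no rotation is needed. -/
theorem openingFactor_closingSide (hc : 0 < c) (hs : s ^ 2 = 1) (hp : p.re = c)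
    (hd : 0 < closingDisc c δ (p.im ^ 2)) :
    openingFactor c δ s p (closingSide c δ s p) = 1 := by
  have h0 := ne_zero_of_re hc hp
  have hy : openingHeight c δ s p (closingSide c δ s p) = p.im := by
    rw [openingHeight, planeDet_closingSide h0, normSq_sub_of_re hp, ← mul_assoc,
      mul_div_cancel_right₀ _ (Real.sqrt_pos.2 hd).ne', ← mul_assoc, ← sq, hs, one_mul]
  rw [openingFactor, hy, ← hp, Complex.re_add_im, div_self h0]

theorem openingFactor_mul_mul {μ : ℂ} (hμ : ‖μ‖ = 1) :
    openingFactor c δ s (μ * p) (μ * w) = openingFactor c δ s p w / μ := by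
  rw [openingFactor, openingFactor, openingHeight, openingHeight, planeDet_mul_mul hμ,
    Complex.normSq_mul, normSq_of_norm_eq_one hμ, one_mul, div_div, mul_comm μ p]

/-- Reflection changes the sign of the determinant, hence of the height, while `c` and `|p|` stay
fixed. -/
theorem openingFactor_conj_conj :
    openingFactor c δ s (starRingEnd ℂ p) (starRingEnd ℂ w) =
      starRingEnd ℂ (openingFactor c δ s p w) := by
  rw [openingFactor, openingFactor, openingHeight, openingHeight, planeDet_conj_conj,
    Complex.normSq_conj, map_div₀, map_add, map_mul, Complex.conj_ofReal, Complex.conj_ofReal,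
    Complex.conj_I, mul_neg, neg_div, Complex.ofReal_neg, neg_mul, mul_neg]

end Triangle

/-! ### The action of `O₂` on polygons -/

section PolygonSpace

theorem polygonSpace_mk_eq_iff {k : ℕ} {β : Fin k → ℝ} {u v : polygonSet β} :
    PolygonSpace.mk β u = PolygonSpace.mk β v ↔ ∃ g : ℂ ≃ₗᵢ[ℝ] ℂ, ∀ i, u.1 i = g (v.1 i) :=
  Quotient.eq

theorem isQuotientMap_polygonSpace_mk {k : ℕ} (β : Fin k → ℝ) :
    IsQuotientMap (PolygonSpace.mk β) :=
  isQuotientMap_quotient_mk'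

theorem map_mem_polygonSet {k : ℕ} {β : Fin k → ℝ} (g : ℂ ≃ₗᵢ[ℝ] ℂ) {v : Fin k → ℂ}
    (hv : v ∈ polygonSet β) : (fun i => g (v i)) ∈ polygonSet β := by
  refine ⟨fun i => by rw [g.norm_map, hv.1 i], ?_⟩
  have h := congrArg g hv.2
  rw [map_sum, map_zero] at h
  rw [← h]
  refine Finset.sum_congr rfl fun i _ => ?_
  rw [← Complex.real_smul, ← Complex.real_smul, map_smul]

theorem hasSmoothSymmetries_polygonSpace {k : ℕ} (β : Fin k → ℝ) :
    HasSmoothSymmetries (PolygonSpace.mk β) := by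
  intro a a' h
  obtain ⟨g, hg⟩ := polygonSpace_mk_eq_iff.1 h
  refine ⟨fun v i => g.symm (v i), ?_, ?_, fun b => ⟨map_mem_polygonSet g.symm b.2, ?_⟩⟩
  · exact contDiff_pi.2 fun i => g.symm.contDiff.comp (contDiff_apply ℝ ℂ i)
  · funext i
    simp [hg i]
  · exact polygonSpace_mk_eq_iff.2 ⟨g.symm, fun i => rfl⟩

/-- Multiplication by a unit complex number, as a linear isometry. -/
theorem exists_linearIsometryEquiv_mul {μ : ℂ} (hμ : ‖μ‖ = 1) :
    ∃ g : ℂ ≃ₗᵢ[ℝ] ℂ, ∀ z, g z = μ * z :=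
  ⟨rotation ⟨μ, mem_sphere_zero_iff_norm.2 hμ⟩, fun z => rotation_apply _ z⟩

/-- A plane isometry is a multiplication by a unit complex number, or a reflection. -/
theorem exists_eq_mul_or_eq_mul_conj (g : ℂ ≃ₗᵢ[ℝ] ℂ) : ∃ μ : ℂ, ‖μ‖ = 1 ∧
    ((∀ z, g z = μ * z) ∨ ∀ z, g z = μ * starRingEnd ℂ z) := by
  obtain ⟨a, rfl | rfl⟩ := linear_isometry_complex g
  · exact ⟨a, a.norm_coe, Or.inl fun z => rotation_apply _ z⟩
  · exact ⟨a, a.norm_coe, Or.inr fun z => rotation_apply _ _⟩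

end PolygonSpace

/-! ### Closing chains and opening polygons -/

section Closing

variable {n : ℕ} {α : Fin (n + 1) → ℝ} {δ s : ℝ}

/-- The first `n` sides of a polygon with `n + 2` sides. -/
def initialSides (u : Fin (n + 2) → ℂ) : Fin n → ℂ := fun i => u i.castSucc.castSucc

theorem mem_polygonSet_extendedLengths {u : Fin (n + 2) → ℂ} :
    u ∈ polygonSet (extendedLengths α δ) ↔ (∀ i, ‖u i‖ = 1) ∧
      chainEnd α (initialSides u) + δ * u (Fin.last n).castSucc +
        (α (Fin.last n) + δ : ℝ) * u (Fin.last (n + 1)) = 0 := by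
  rw [polygonSet, mem_ofPred_eq, Fin.sum_univ_castSucc, Fin.sum_univ_castSucc]
  simp only [extendedLengths, Fin.snoc_castSucc, Fin.snoc_last]
  rfl

theorem norm_chainEnd_lt (hpos : ∀ i, 0 < α i) (hδ : ∑ i : Fin n, α i.castSucc < δ)
    {v : Fin n → ℂ} (hv : ∀ i, ‖v i‖ = 1) : ‖chainEnd α v‖ < δ := by
  refine lt_of_le_of_lt (norm_sum_le _ _) (lt_of_le_of_lt (le_of_eq ?_) hδ)
  refine Finset.sum_congr rfl fun i _ => ?_
  rw [norm_mul, hv i, mul_one, Complex.norm_real, Real.norm_of_nonneg (hpos _).le]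

theorem pos_of_sum_lt (hpos : ∀ i, 0 < α i) (hδ : ∑ i : Fin n, α i.castSucc < δ) : 0 < δ :=
  lt_of_le_of_lt (Finset.sum_nonneg fun _ _ => (hpos _).le) hδ

theorem closingDisc_chainEnd_pos (hpos : ∀ i, 0 < α i) (hδ : ∑ i : Fin n, α i.castSucc < δ)
    {v : Fin n → ℂ} (hv : ∀ i, ‖v i‖ = 1) :
    0 < closingDisc (α (Fin.last n)) δ
      (Complex.normSq (chainEnd α v) - α (Fin.last n) ^ 2) := by
  refine closingDisc_pos (hpos _) (pos_of_sum_lt hpos hδ) ?_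
  rw [Complex.normSq_eq_norm_sq]
  have h1 := pow_lt_pow_left₀ (norm_chainEnd_lt hpos hδ hv) (norm_nonneg _) two_ne_zero
  linarith [sq_nonneg (α (Fin.last n))]

theorem closingDisc_chain_pos (hpos : ∀ i, 0 < α i) (hδ : ∑ i : Fin n, α i.castSucc < δ)
    {v : Fin n → ℂ} (hv : v ∈ chainSet α) :
    0 < closingDisc (α (Fin.last n)) δ ((chainEnd α v).im ^ 2) := by
  rw [← normSq_sub_of_re hv.2]
  exact closingDisc_chainEnd_pos hpos hδ hv.1

/-- The polygon obtained by closing a chain with a triangle. -/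
noncomputable def closeChain (α : Fin (n + 1) → ℝ) (δ s : ℝ) (v : Fin n → ℂ) : Fin (n + 2) → ℂ :=
  Fin.snoc (α := fun _ => ℂ)
    (Fin.snoc (α := fun _ => ℂ) v (closingSide (α (Fin.last n)) δ s (chainEnd α v)))
    (remainingSide (α (Fin.last n)) δ (chainEnd α v)
      (closingSide (α (Fin.last n)) δ s (chainEnd α v)))

/-- The chain obtained by removing the last two sides of a polygon and rotating. -/
noncomputable def openPolygon (α : Fin (n + 1) → ℝ) (δ s : ℝ) (u : Fin (n + 2) → ℂ) : Fin n → ℂ :=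
  fun i => openingFactor (α (Fin.last n)) δ s (chainEnd α (initialSides u))
    (u (Fin.last n).castSucc) * initialSides u i

theorem initialSides_closeChain (v : Fin n → ℂ) : initialSides (closeChain α δ s v) = v := by
  funext i
  simp [initialSides, closeChain]

theorem closeChain_side (v : Fin n → ℂ) : closeChain α δ s v (Fin.last n).castSucc =
    closingSide (α (Fin.last n)) δ s (chainEnd α v) := by
  simp [closeChain]

theorem closeChain_last (v : Fin n → ℂ) : closeChain α δ s v (Fin.last (n + 1)) =
    remainingSide (α (Fin.last n)) δ (chainEnd α v)
      (closingSide (α (Fin.last n)) δ s (chainEnd α v)) := by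
  simp [closeChain]

theorem chainEnd_mul (μ : ℂ) (v : Fin n → ℂ) :
    chainEnd α (fun i => μ * v i) = μ * chainEnd α v := by
  rw [chainEnd, chainEnd, Finset.mul_sum]
  exact Finset.sum_congr rfl fun i _ => mul_left_comm _ _ _

theorem closeChain_mem (hpos : ∀ i, 0 < α i) (hδ : ∑ i : Fin n, α i.castSucc < δ)
    (hs : s ^ 2 = 1) {v : Fin n → ℂ} (hv : v ∈ chainSet α) :
    closeChain α δ s v ∈ polygonSet (extendedLengths α δ) := by
  have hd := closingDisc_chain_pos hpos hδ hv
  have hδ0 := pos_of_sum_lt hpos hδ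
  refine mem_polygonSet_extendedLengths.2 ⟨fun i => ?_, ?_⟩
  · refine Fin.lastCases ?_ (fun i => ?_) i
    · rw [closeChain_last]
      exact norm_remainingSide (hpos _) hδ0 hs hv.2 hd
    · refine Fin.lastCases ?_ (fun i => ?_) i
      · rw [closeChain_side]
        exact norm_closingSide (hpos _) hδ0 hs hv.2 hd
      · exact (congrArg norm (congrFun (initialSides_closeChain v) i)).trans (hv.1 i)
  · rw [initialSides_closeChain, closeChain_side, closeChain_last]
    exact add_remainingSide (add_pos (hpos _) hδ0).ne'

theorem closesChain_closeChain (hpos : ∀ i, 0 < α i) (v : chainSet α)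
    (h : closeChain α δ s v.1 ∈ polygonSet (extendedLengths α δ)) :
    ClosesChain α δ s v ⟨closeChain α δ s v.1, h⟩ := by
  refine ⟨congrFun (initialSides_closeChain v.1), ?_⟩
  change 0 ≤ s * (chainEnd α v.1).im *
    planeDet (chainEnd α v.1) (closeChain α δ s v.1 (Fin.last n).castSucc)
  rw [closeChain_side]
  exact closingSide_side (hpos _) v.2.2

/-- Uniqueness of the triangle on the prescribed side. It lets polygons be identified by checking
`ClosesChain` rather than by computing with the formulas. -/
theorem ClosesChain.eq_closeChain (hpos : ∀ i, 0 < α i) (hδ : ∑ i : Fin n, α i.castSucc < δ)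
    (hs : s ^ 2 = 1) {v : chainSet α} {P : polygonSet (extendedLengths α δ)}
    (h : ClosesChain α δ s v P) : P.1 = closeChain α δ s v.1 := by
  have hd := closingDisc_chain_pos hpos hδ v.2
  have hδ0 := pos_of_sum_lt hpos hδ
  obtain ⟨hn, hP⟩ := mem_polygonSet_extendedLengths.1 P.2
  have hi : initialSides P.1 = v.1 := funext h.1
  rw [hi] at hP
  have hw := eq_closingSide (hpos _) hδ0 hs v.2.2 hd (hn _) (hn _) hP h.2
  have hx := eq_remainingSide (add_pos (hpos _) hδ0).ne' hP
  funext i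
  refine Fin.lastCases ?_ (fun i => ?_) i
  · rw [closeChain_last, hx, hw]
  · refine Fin.lastCases ?_ (fun i => ?_) i
    · rw [closeChain_side, hw]
    · exact (h.1 i).trans (congrFun (initialSides_closeChain v.1) i).symm

theorem chainEnd_initialSides_ne_zero (hpos : ∀ i, 0 < α i) (hδ : ∑ i : Fin n, α i.castSucc < δ)
    {u : Fin (n + 2) → ℂ} (hu : u ∈ polygonSet (extendedLengths α δ)) :
    chainEnd α (initialSides u) ≠ 0 := by
  obtain ⟨hn, hP⟩ := mem_polygonSet_extendedLengths.1 hu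
  exact norm_pos_iff.1 ((hpos _).trans_le
    (le_norm_of_triangle (hpos _) (pos_of_sum_lt hpos hδ) (hn _) (hn _) hP))

theorem norm_openingFactor_polygon (hpos : ∀ i, 0 < α i) (hδ : ∑ i : Fin n, α i.castSucc < δ)
    (hs : s ^ 2 = 1) {u : Fin (n + 2) → ℂ} (hu : u ∈ polygonSet (extendedLengths α δ)) :
    ‖openingFactor (α (Fin.last n)) δ s (chainEnd α (initialSides u))
      (u (Fin.last n).castSucc)‖ = 1 := by
  obtain ⟨hn, hP⟩ := mem_polygonSet_extendedLengths.1 hu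
  exact norm_openingFactor (chainEnd_initialSides_ne_zero hpos hδ hu) (pos_of_sum_lt hpos hδ) hs
    (closingDisc_chainEnd_pos hpos hδ fun i => hn _) (hn _) (hn _) hP

theorem chainEnd_openPolygon_eq_mul (u : Fin (n + 2) → ℂ) :
    chainEnd α (openPolygon α δ s u) =
      openingFactor (α (Fin.last n)) δ s (chainEnd α (initialSides u)) (u (Fin.last n).castSucc) *
        chainEnd α (initialSides u) :=
  chainEnd_mul _ _

theorem chainEnd_openPolygon (hpos : ∀ i, 0 < α i) (hδ : ∑ i : Fin n, α i.castSucc < δ)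
    {u : Fin (n + 2) → ℂ} (hu : u ∈ polygonSet (extendedLengths α δ)) :
    chainEnd α (openPolygon α δ s u) = α (Fin.last n) + openingHeight (α (Fin.last n)) δ s
      (chainEnd α (initialSides u)) (u (Fin.last n).castSucc) * Complex.I := by
  rw [chainEnd_openPolygon_eq_mul, openingFactor_mul (chainEnd_initialSides_ne_zero hpos hδ hu)]

theorem openPolygon_mem (hpos : ∀ i, 0 < α i) (hδ : ∑ i : Fin n, α i.castSucc < δ)
    (hs : s ^ 2 = 1) {u : Fin (n + 2) → ℂ} (hu : u ∈ polygonSet (extendedLengths α δ)) :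
    openPolygon α δ s u ∈ chainSet α := by
  refine ⟨fun i => ?_, ?_⟩
  · rw [openPolygon, norm_mul, norm_openingFactor_polygon hpos hδ hs hu, one_mul]
    exact hu.1 _
  · rw [chainEnd_openPolygon hpos hδ hu, re_ofReal_add_mul_I]

theorem openPolygon_closeChain (hpos : ∀ i, 0 < α i) (hδ : ∑ i : Fin n, α i.castSucc < δ)
    (hs : s ^ 2 = 1) {v : Fin n → ℂ} (hv : v ∈ chainSet α) :
    openPolygon α δ s (closeChain α δ s v) = v := by
  funext i
  rw [openPolygon, initialSides_closeChain, closeChain_side,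
    openingFactor_closingSide (hpos _) hs hv.2 (closingDisc_chain_pos hpos hδ hv), one_mul]

theorem mk_closeChain_openPolygon (hpos : ∀ i, 0 < α i) (hδ : ∑ i : Fin n, α i.castSucc < δ)
    (hs : s ^ 2 = 1) (P : polygonSet (extendedLengths α δ)) :
    PolygonSpace.mk (extendedLengths α δ) ⟨closeChain α δ s (openPolygon α δ s P.1),
      closeChain_mem hpos hδ hs (openPolygon_mem hpos hδ hs P.2)⟩ =
      PolygonSpace.mk (extendedLengths α δ) P := by
  have hμ := norm_openingFactor_polygon hpos hδ hs P.2
  obtain ⟨g, hg⟩ := exists_linearIsometryEquiv_mul hμ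
  -- The rotated polygon closes the opened chain: its determinant is unchanged and the height was
  -- given the matching sign. Uniqueness then identifies it with the `closeChain` polygon.
  have hc : ClosesChain α δ s ⟨openPolygon α δ s P.1, openPolygon_mem hpos hδ hs P.2⟩
      ⟨fun i => g (P.1 i), map_mem_polygonSet g P.2⟩ := by
    refine ⟨fun i => hg _, ?_⟩
    change 0 ≤ s * (chainEnd α (openPolygon α δ s P.1)).im *
      planeDet (chainEnd α (openPolygon α δ s P.1)) (g (P.1 (Fin.last n).castSucc))
    rw [hg, chainEnd_openPolygon_eq_mul, planeDet_mul_mul hμ,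
      openingFactor_mul (chainEnd_initialSides_ne_zero hpos hδ P.2), im_ofReal_add_mul_I,
      openingHeight, mul_div_assoc', div_mul_eq_mul_div]
    refine div_nonneg ?_ (Real.sqrt_nonneg _)
    rw [← mul_assoc, ← sq, hs, one_mul]
    exact mul_self_nonneg _
  refine polygonSpace_mk_eq_iff.2 ⟨g, fun i => ?_⟩
  exact (congrFun (hc.eq_closeChain hpos hδ hs) i).symm

/-- Reflection negates both `y` and `det (p, w)`, so the mirror image of a closing polygon closes
the mirror chain on the side given by the same `s`. -/
theorem mk_closeChain_eq (hpos : ∀ i, 0 < α i) (hδ : ∑ i : Fin n, α i.castSucc < δ)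
    (hs : s ^ 2 = 1) (u v : chainSet α) (h : ChainSpace.mk α u = ChainSpace.mk α v) :
    PolygonSpace.mk (extendedLengths α δ) ⟨closeChain α δ s u.1, closeChain_mem hpos hδ hs u.2⟩ =
      PolygonSpace.mk (extendedLengths α δ)
        ⟨closeChain α δ s v.1, closeChain_mem hpos hδ hs v.2⟩ := by
  rcases chainSpace_mk_eq_iff.1 h with rfl | h
  · rfl
  · have hu : u.1 = fun i => starRingEnd ℂ (v.1 i) := funext h
    have hv := closesChain_closeChain hpos v (closeChain_mem hpos hδ hs v.2)
    have hc : ClosesChain α δ s u ⟨fun i => Complex.conjLIE (closeChain α δ s v.1 i),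
        map_mem_polygonSet Complex.conjLIE (closeChain_mem hpos hδ hs v.2)⟩ := by
      refine ⟨fun i => ?_, ?_⟩
      · rw [h i, ← hv.1 i]
        rfl
      · change 0 ≤ s * (chainEnd α u.1).im * planeDet (chainEnd α u.1)
          (starRingEnd ℂ (closeChain α δ s v.1 (Fin.last n).castSucc))
        rw [hu, chainEnd_conj, planeDet_conj_conj, Complex.conj_im, mul_neg, mul_neg, neg_mul,
          neg_neg]
        exact hv.2
    refine polygonSpace_mk_eq_iff.2 ⟨Complex.conjLIE, fun i => ?_⟩
    exact (congrFun (hc.eq_closeChain hpos hδ hs) i).symm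

theorem openPolygon_mul {μ : ℂ} (hμ : ‖μ‖ = 1) (u : Fin (n + 2) → ℂ) :
    openPolygon α δ s (fun i => μ * u i) = openPolygon α δ s u := by
  have h0 : μ ≠ 0 := norm_ne_zero_iff.1 (hμ ▸ one_ne_zero)
  have h1 : initialSides (fun i => μ * u i) = fun i => μ * initialSides u i := rfl
  funext i
  rw [openPolygon, openPolygon, h1, chainEnd_mul, openingFactor_mul_mul hμ, ← mul_assoc,
    div_mul_cancel₀ _ h0]

theorem openPolygon_conj (u : Fin (n + 2) → ℂ) :
    openPolygon α δ s (fun i => starRingEnd ℂ (u i)) =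
      fun i => starRingEnd ℂ (openPolygon α δ s u i) := by
  have h1 : initialSides (fun i => starRingEnd ℂ (u i)) =
    fun i => starRingEnd ℂ (initialSides u i) := rfl
  funext i
  rw [openPolygon, openPolygon, h1, chainEnd_conj, openingFactor_conj_conj, map_mul]

/-- Rotations of the polygon do not change the opened chain, and reflections conjugate it: `O₂` acts
on opened chains through `O₂ / SO₂ = ℤ/2`. -/
theorem mk_openPolygon_eq (hpos : ∀ i, 0 < α i) (hδ : ∑ i : Fin n, α i.castSucc < δ)
    (hs : s ^ 2 = 1) (P Q : polygonSet (extendedLengths α δ))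
    (h : PolygonSpace.mk _ P = PolygonSpace.mk _ Q) :
    ChainSpace.mk α ⟨openPolygon α δ s P.1, openPolygon_mem hpos hδ hs P.2⟩ =
      ChainSpace.mk α ⟨openPolygon α δ s Q.1, openPolygon_mem hpos hδ hs Q.2⟩ := by
  obtain ⟨g, hg⟩ := polygonSpace_mk_eq_iff.1 h
  obtain ⟨μ, hμ, hgμ | hgμ⟩ := exists_eq_mul_or_eq_mul_conj g
  · have hP : P.1 = fun i => μ * Q.1 i := funext fun i => (hg i).trans (hgμ _)
    refine congrArg _ (Subtype.ext ?_)
    change openPolygon α δ s P.1 = openPolygon α δ s Q.1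
    rw [hP, openPolygon_mul hμ]
  · have hP : P.1 = fun i => μ * starRingEnd ℂ (Q.1 i) := funext fun i => (hg i).trans (hgμ _)
    refine chainSpace_mk_eq_iff.2 (Or.inr fun i => ?_)
    change openPolygon α δ s P.1 i = _
    rw [hP, openPolygon_mul hμ, openPolygon_conj]

end Closing

/-! ### Smoothness of both constructions on ambient open sets -/

section Smoothness

variable {n : ℕ} {α : Fin (n + 1) → ℝ} {δ s : ℝ}

theorem contDiff_chainEnd (α : Fin (n + 1) → ℝ) : ContDiff ℝ ∞ (chainEnd α) := by
  unfold chainEnd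
  exact ContDiff.sum fun i _ => contDiff_const.mul (contDiff_apply ℝ ℂ i)

theorem contDiff_initialSides : ContDiff ℝ ∞ (initialSides (n := n)) :=
  contDiff_pi.2 fun i => contDiff_apply ℝ ℂ i.castSucc.castSucc

theorem contDiff_normSq : ContDiff ℝ ∞ (Complex.normSq : ℂ → ℝ) := by
  have h : (Complex.normSq : ℂ → ℝ) = fun z => z.re * z.re + z.im * z.im :=
    funext Complex.normSq_apply
  rw [h]
  exact (Complex.reCLM.contDiff.mul Complex.reCLM.contDiff).add
    (Complex.imCLM.contDiff.mul Complex.imCLM.contDiff)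

theorem contDiff_closingDisc (c δ : ℝ) : ContDiff ℝ ∞ (closingDisc c δ) := by
  unfold closingDisc
  fun_prop

/-- The tuples of directions near the chains, to which `closeChain` extends smoothly. -/
def closingDomain (α : Fin (n + 1) → ℝ) (δ : ℝ) : Set (Fin n → ℂ) :=
  {v | chainEnd α v ≠ 0 ∧ 0 < closingDisc (α (Fin.last n)) δ ((chainEnd α v).im ^ 2)}

/-- The tuples of directions near the closed polygons, to which `openPolygon` extends smoothly. -/
def openingDomain (α : Fin (n + 1) → ℝ) (δ : ℝ) : Set (Fin (n + 2) → ℂ) :=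
  {u | chainEnd α (initialSides u) ≠ 0 ∧ 0 < closingDisc (α (Fin.last n)) δ
    (Complex.normSq (chainEnd α (initialSides u)) - α (Fin.last n) ^ 2)}

theorem isOpen_closingDomain (α : Fin (n + 1) → ℝ) (δ : ℝ) : IsOpen (closingDomain α δ) := by
  have h := (contDiff_chainEnd α).continuous
  exact (isOpen_ne_fun h continuous_const).inter (isOpen_lt continuous_const
    ((contDiff_closingDisc _ _).continuous.comp ((Complex.continuous_im.comp h).pow 2)))

theorem isOpen_openingDomain (α : Fin (n + 1) → ℝ) (δ : ℝ) : IsOpen (openingDomain α δ) := by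
  have h := (contDiff_chainEnd α).continuous.comp contDiff_initialSides.continuous
  exact (isOpen_ne_fun h continuous_const).inter (isOpen_lt continuous_const
    ((contDiff_closingDisc _ _).continuous.comp
      ((contDiff_normSq.continuous.comp h).sub continuous_const)))

theorem chainSet_subset_closingDomain (hpos : ∀ i, 0 < α i)
    (hδ : ∑ i : Fin n, α i.castSucc < δ) : chainSet α ⊆ closingDomain α δ :=
  fun _ hv => ⟨ne_zero_of_re (hpos _) hv.2, closingDisc_chain_pos hpos hδ hv⟩

theorem polygonSet_subset_openingDomain (hpos : ∀ i, 0 < α i)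
    (hδ : ∑ i : Fin n, α i.castSucc < δ) :
    polygonSet (extendedLengths α δ) ⊆ openingDomain α δ :=
  fun _ hu => ⟨chainEnd_initialSides_ne_zero hpos hδ hu,
    closingDisc_chainEnd_pos hpos hδ fun _ => hu.1 _⟩

theorem contDiffOn_closingSide (α : Fin (n + 1) → ℝ) (δ s : ℝ) :
    ContDiffOn ℝ ∞ (fun v => closingSide (α (Fin.last n)) δ s (chainEnd α v))
      (closingDomain α δ) := by
  simp only [closingSide, div_eq_mul_inv]
  have hp := contDiff_chainEnd α
  have hy : ContDiff ℝ ∞ fun v => (chainEnd α v).im := Complex.imCLM.contDiff.comp hp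
  have hr : ContDiffOn ℝ ∞
      (fun v => √(closingDisc (α (Fin.last n)) δ ((chainEnd α v).im ^ 2)))
      (closingDomain α δ) :=
    ((contDiff_closingDisc _ _).comp (hy.pow 2)).contDiffOn.sqrt fun v hv => hv.2.ne'
  refine ContDiffOn.mul (ContDiffOn.add ?_ (ContDiffOn.mul ?_ contDiffOn_const))
    (ContDiffOn.inv ?_ ?_)
  · exact (Complex.ofRealCLM.contDiff.comp
      (contDiff_const.sub ((hy.pow 2).div_const _))).contDiffOn
  · exact Complex.ofRealCLM.contDiff.comp_contDiffOn
      (((contDiff_const.mul hy).contDiffOn).mul hr)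
  · exact (Complex.conjCLE.contDiff.comp hp).contDiffOn
  · exact fun v hv => (map_ne_zero _).2 hv.1

theorem contDiffOn_closeChain (α : Fin (n + 1) → ℝ) (δ s : ℝ) :
    ContDiffOn ℝ ∞ (closeChain α δ s) (closingDomain α δ) := by
  have hw := contDiffOn_closingSide α δ s
  refine contDiffOn_pi.2 fun i => ?_
  refine Fin.lastCases ?_ (fun i => ?_) i
  · simp only [closeChain_last]
    simp only [remainingSide, div_eq_mul_inv]
    exact (((contDiff_chainEnd α).contDiffOn.add (contDiffOn_const.mul hw)).neg).mul contDiffOn_const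
  · refine Fin.lastCases ?_ (fun i => ?_) i
    · simp only [closeChain_side]
      exact hw
    · have h : (fun v => closeChain α δ s v i.castSucc.castSucc) = fun v => v i :=
        funext fun v => congrFun (initialSides_closeChain v) i
      rw [h]
      exact (contDiff_apply ℝ ℂ i).contDiffOn

theorem contDiffOn_openPolygon (α : Fin (n + 1) → ℝ) (δ s : ℝ) :
    ContDiffOn ℝ ∞ (openPolygon α δ s) (openingDomain α δ) := by
  have hi := contDiff_initialSides (n := n)
  have hp : ContDiff ℝ ∞ fun u : Fin (n + 2) → ℂ => chainEnd α (initialSides u) :=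
    (contDiff_chainEnd α).comp hi
  have hw : ContDiff ℝ ∞ fun u : Fin (n + 2) → ℂ => u (Fin.last n).castSucc :=
    contDiff_apply ℝ ℂ _
  have hr : ContDiffOn ℝ ∞ (fun u => √(closingDisc (α (Fin.last n)) δ
      (Complex.normSq (chainEnd α (initialSides u)) - α (Fin.last n) ^ 2)))
      (openingDomain α δ) :=
    ((contDiff_closingDisc _ _).comp ((contDiff_normSq.comp hp).sub contDiff_const)).contDiffOn.sqrt
      fun u hu => hu.2.ne'
  have hdet : ContDiff ℝ ∞ fun u : Fin (n + 2) → ℂ =>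
      planeDet (chainEnd α (initialSides u)) (u (Fin.last n).castSucc) := by
    unfold planeDet
    exact ((Complex.reCLM.contDiff.comp hp).mul (Complex.imCLM.contDiff.comp hw)).sub
      ((Complex.imCLM.contDiff.comp hp).mul (Complex.reCLM.contDiff.comp hw))
  have hy : ContDiffOn ℝ ∞ (fun u => openingHeight (α (Fin.last n)) δ s
      (chainEnd α (initialSides u)) (u (Fin.last n).castSucc)) (openingDomain α δ) :=
    (contDiff_const.mul hdet).contDiffOn.div hr fun u hu => (Real.sqrt_pos.2 hu.2).ne'
  have hμ : ContDiffOn ℝ ∞ (fun u => openingFactor (α (Fin.last n)) δ s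
      (chainEnd α (initialSides u)) (u (Fin.last n).castSucc)) (openingDomain α δ) := by
    simp only [openingFactor, div_eq_mul_inv]
    exact (contDiffOn_const.add ((Complex.ofRealCLM.contDiff.comp_contDiffOn hy).mul
      contDiffOn_const)).mul (hp.contDiffOn.inv fun u hu => hu.1)
  exact contDiffOn_pi.2 fun i => hμ.mul ((contDiff_apply ℝ ℂ i).comp hi).contDiffOn

/-- The polygon space has a slice at every point. -/
theorem exists_slice_polygonSpace (hpos : ∀ i, 0 < α i) (hgen : IsGeneric α)
    (hδ : ∑ i : Fin n, α i.castSucc < δ) (P : polygonSet (extendedLengths α δ)) :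
    ∃ φ : SmoothSlice (EuclideanSpace ℝ (Fin (n - 1))) (PolygonSpace.mk (extendedLengths α δ)),
      P.1 ∈ φ.dom := by
  -- Either sign would give slices of the polygon space.
  have hs : (1 : ℝ) ^ 2 = 1 := one_pow 2
  obtain ⟨φ, hφ⟩ := exists_slice_chainSpace hpos hgen
    ⟨openPolygon α δ 1 P.1, openPolygon_mem hpos hδ hs P.2⟩
  exact ⟨φ.transfer (isOpen_openingDomain α δ) (chainSet_subset_closingDomain hpos hδ)
    (polygonSet_subset_openingDomain hpos hδ) (contDiffOn_closeChain α δ 1)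
    (contDiffOn_openPolygon α δ 1) (fun _ hv => closeChain_mem hpos hδ hs hv)
    (fun _ hu => openPolygon_mem hpos hδ hs hu) (fun _ hv => openPolygon_closeChain hpos hδ hs hv)
    (mk_closeChain_eq hpos hδ hs) (mk_closeChain_openPolygon hpos hδ hs)
    (mk_openPolygon_eq hpos hδ hs), polygonSet_subset_openingDomain hpos hδ P.2, hφ⟩

/-- Closing chains with triangles, as a bijection of the chain space with the polygon space. -/
noncomputable def closingEquiv (hpos : ∀ i, 0 < α i) (hδ : ∑ i : Fin n, α i.castSucc < δ)
    (hs : s ^ 2 = 1) : ChainSpace α ≃ PolygonSpace (extendedLengths α δ) where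
  toFun := Quotient.lift
    (fun v : chainSet α => PolygonSpace.mk (extendedLengths α δ)
      ⟨closeChain α δ s v.1, closeChain_mem hpos hδ hs v.2⟩)
    fun u v h => mk_closeChain_eq hpos hδ hs u v (Quotient.sound h)
  invFun := Quotient.lift
    (fun P : polygonSet (extendedLengths α δ) => ChainSpace.mk α
      ⟨openPolygon α δ s P.1, openPolygon_mem hpos hδ hs P.2⟩)
    fun P Q h => mk_openPolygon_eq hpos hδ hs P Q (Quotient.sound h)
  left_inv := by
    rintro ⟨v⟩
    exact congrArg (ChainSpace.mk α) (Subtype.ext (openPolygon_closeChain hpos hδ hs v.2))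
  right_inv := by
    rintro ⟨P⟩
    exact mk_closeChain_openPolygon hpos hδ hs P

end Smoothness

/-! ### The diffeomorphism theorem -/

theorem proposition3p3 (n : ℕ) (α : Fin (n + 1) → ℝ) (hpos : ∀ i, 0 < α i)
    (hgen : IsGeneric α) (δ : ℝ) (hδ : ∑ i : Fin n, α i.castSucc < δ) :
    -- both spaces carry their natural smooth structure, of dimension `m - 2 = n - 1`
    (∃ _ : ChartedSpace (EuclideanSpace ℝ (Fin (n - 1))) (ChainSpace α),
      IsNaturalSmoothStructure (n - 1) (ChainSpace.mk α)) ∧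
    (∃ _ : ChartedSpace (EuclideanSpace ℝ (Fin (n - 1))) (PolygonSpace (extendedLengths α δ)),
      IsNaturalSmoothStructure (n - 1) (PolygonSpace.mk (extendedLengths α δ))) ∧
    -- on either choice of the side, each chain is closed by exactly one triangle
    (∀ s : ℝ, s = 1 ∨ s = -1 → ∀ v : chainSet α,
      ∃! P : polygonSet (extendedLengths α δ), ClosesChain α δ s v P) ∧
    -- and closing the chains induces a diffeomorphism
    (∀ (_ : ChartedSpace (EuclideanSpace ℝ (Fin (n - 1))) (ChainSpace α))
        (_ : ChartedSpace (EuclideanSpace ℝ (Fin (n - 1)))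
          (PolygonSpace (extendedLengths α δ))),
      IsNaturalSmoothStructure (n - 1) (ChainSpace.mk α) →
      IsNaturalSmoothStructure (n - 1) (PolygonSpace.mk (extendedLengths α δ)) →
      ∀ s : ℝ, s = 1 ∨ s = -1 →
        ∃ Φ : ChainSpace α ≃ₘ^∞⟮𝓡 (n - 1), 𝓡 (n - 1)⟯ PolygonSpace (extendedLengths α δ),
          ∀ (v : chainSet α) (P : polygonSet (extendedLengths α δ)),
            ClosesChain α δ s v P →
              Φ (ChainSpace.mk α v) = PolygonSpace.mk (extendedLengths α δ) P) := by
  have hqC := isQuotientMap_chainSpace_mk α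
  have hqP := isQuotientMap_polygonSpace_mk (extendedLengths α δ)
  refine ⟨exists_isNaturalSmoothStructure hqC (hasSmoothSymmetries_chainSpace α)
      (exists_slice_chainSpace hpos hgen),
    exists_isNaturalSmoothStructure hqP (hasSmoothSymmetries_polygonSpace _)
      (exists_slice_polygonSpace hpos hgen hδ), fun s hs v => ?_, ?_⟩
  · have hs := sq_eq_one_iff.2 hs
    exact ⟨⟨_, closeChain_mem hpos hδ hs v.2⟩, closesChain_closeChain hpos v _,
      fun P hP => Subtype.ext (hP.eq_closeChain hpos hδ hs)⟩
  · intro _ _ hX hY s hs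
    have hs := sq_eq_one_iff.2 hs
    have hclose : LiftsSmoothly (ChainSpace.mk α) (PolygonSpace.mk (extendedLengths α δ))
        (closingEquiv hpos hδ hs) :=
      .of_contDiffOn (isOpen_closingDomain α δ) (chainSet_subset_closingDomain hpos hδ)
        (contDiffOn_closeChain α δ s) fun v => ⟨closeChain_mem hpos hδ hs v.2, rfl⟩
    have hopen : LiftsSmoothly (PolygonSpace.mk (extendedLengths α δ)) (ChainSpace.mk α)
        (closingEquiv hpos hδ hs).symm :=
      .of_contDiffOn (isOpen_openingDomain α δ) (polygonSet_subset_openingDomain hpos hδ)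
        (contDiffOn_openPolygon α δ s) fun P => ⟨openPolygon_mem hpos hδ hs P.2, rfl⟩
    refine ⟨⟨closingEquiv hpos hδ hs, hclose.contMDiff hX hY hqC hqP.continuous,
      hopen.contMDiff hY hX hqP hqC.continuous⟩, fun v P hP => ?_⟩
    exact congrArg (PolygonSpace.mk _) (Subtype.ext (hP.eq_closeChain hpos hδ hs).symm)
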